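/- A \emph{monotone Boolean formula} is a formula built from variables $x_0, x_1, x_2, \dots$ with binary $\land$ and $\lor$ only (no negations and no constants). It is \emph{read-once} if every variable occurs in it at most once, and a Boolean function is \emph{read-once} if it is computed by some monotone read-once formula. A \emph{monotone CNF} is a non-empty conjunction of non-empty disjunctions of variables, and a \emph{monotone DNF} is a non-empty disjunction of non-empty conjunctions of variables; such a CNF or DNF is \emph{read-once} if every variable occurs in it at most once. \textbf{Theorem.} There is a polynomial-time algorithm that, given an expression $C \lor D$ where $C$ is a monotone read-once CNF, $D$ is a monotone read-once DNF, and every variable of $C$ also occurs in $D$, decides whether the Boolean function computed by $C \lor D$ is read-once. That is, there are a multi-stack (equivalently, multi-tape) Turing machine $M$ with finite alphabets and a polynomial $p$ such that for every such pair $(C, D)$, written as a string $w$ over a fixed finite alphabet (clause by clause, the indices of the variables in binary), $M$ halts on $w$ after at most $p(|w|)$ steps and outputs $1$ if the function $C \lor D$ is read-once and $0$ otherwise. -/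

import Mathlib

namespace ReadOnce

/-- Monotone Boolean formulas, i.e. `∧,∨`-formulas, over the variables `x₀, x₁, x₂, …`.
There are no negations and no constants. -/
inductive MonotoneFormula where
  | var (x : ℕ) : MonotoneFormula
  | and (φ ψ : MonotoneFormula) : MonotoneFormula
  | or (φ ψ : MonotoneFormula) : MonotoneFormula

namespace MonotoneFormula

/-- The Boolean function computed by a formula. -/
def eval (v : ℕ → Bool) : MonotoneFormula → Bool
  | var x => v x
  | and φ ψ => φ.eval v && ψ.eval v
  | or φ ψ => φ.eval v || ψ.eval v

/-- The number of occurrences of the variable `x` in a formula. -/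
def occurrences (x : ℕ) : MonotoneFormula → ℕ
  | var y => if y = x then 1 else 0
  | and φ ψ => φ.occurrences x + ψ.occurrences x
  | or φ ψ => φ.occurrences x + ψ.occurrences x

/-- A formula is read-once if every variable occurs in it at most once. -/
def IsReadOnce (φ : MonotoneFormula) : Prop :=
  ∀ x, φ.occurrences x ≤ 1

end MonotoneFormula

/-- A Boolean function is read-once if some monotone read-once formula computes it. -/
def IsReadOnceFunction (f : (ℕ → Bool) → Bool) : Prop :=
  ∃ φ : MonotoneFormula, φ.IsReadOnce ∧ ∀ v, φ.eval v = f v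

/-- The common syntax of monotone CNFs and monotone DNFs: the list of the clauses (resp. of the
conjunctions), each of them given by the list of its variables. -/
abbrev Groups := List (List ℕ)

namespace Groups

/-- The value of `L` read as a CNF: a conjunction of disjunctions. -/
def evalCNF (L : Groups) (v : ℕ → Bool) : Bool :=
  L.all fun c => c.any v

/-- The value of `L` read as a DNF: a disjunction of conjunctions. -/
def evalDNF (L : Groups) (v : ℕ → Bool) : Bool :=
  L.any fun d => d.all v

/-- The lists that spell out a genuine `∧,∨`-formula: there is at least one group and no group is
empty (an empty conjunction or disjunction would be a constant). -/
def IsFormula (L : Groups) : Prop :=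
  L ≠ [] ∧ ∀ c ∈ L, c ≠ []

/-- `x` occurs in `L`. -/
def Occurs (x : ℕ) (L : Groups) : Prop :=
  ∃ c ∈ L, x ∈ c

/-- Every variable occurs at most once in `L`. -/
def IsReadOnce (L : Groups) : Prop :=
  ∀ x, L.flatten.count x ≤ 1

end Groups

/-- An expression `C ∨ D`, where `C` is a monotone CNF and `D` is a monotone DNF. -/
structure Expression where
  /-- the CNF `C` -/
  cnf : Groups
  /-- the DNF `D` -/
  dnf : Groups

namespace Expression

/-- The Boolean function computed by the expression `C ∨ D`. -/
def eval (E : Expression) (v : ℕ → Bool) : Bool :=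
  E.cnf.evalCNF v || E.dnf.evalDNF v

/-- The admissible inputs: `C` is a monotone read-once CNF, `D` is a monotone read-once DNF,
and every variable of `C` occurs also in `D`. -/
structure Admissible (E : Expression) : Prop where
  cnf_isFormula : E.cnf.IsFormula
  dnf_isFormula : E.dnf.IsFormula
  cnf_readOnce : E.cnf.IsReadOnce
  dnf_readOnce : E.dnf.IsReadOnce
  occurs : ∀ x, E.cnf.Occurs x → E.dnf.Occurs x

end Expression

/-- The finite alphabet in which expressions are written down. -/
inductive Symb where
  | bit (b : Bool) : Symb
  | endVar : Symb
  | endGroup : Symb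
  | or : Symb
  deriving DecidableEq, Fintype

/-- The variable `x` is written as its index in binary, followed by an end marker. -/
def encodeVar (x : ℕ) : List Symb :=
  (Computability.encodeNat x).map Symb.bit ++ [Symb.endVar]

/-- The variables of all groups in order, with an end marker after each group. -/
def encodeGroups (L : Groups) : List Symb :=
  L.flatMap fun c => c.flatMap encodeVar ++ [Symb.endGroup]

/-- The string that represents the expression `C ∨ D`. -/
def encodeExpression (E : Expression) : List Symb :=
  encodeGroups E.cnf ++ Symb.or :: encodeGroups E.dnf

/-- There is a polynomial-time algorithm that decides `P a` for all `a` with `promise a`, when `a`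
is given by the string `enc a`: one multi-stack Turing machine, with finite stack alphabets, that on
the input `enc a` halts after at most `p (length of enc a)` steps with the answer as its output,
where `p` is one polynomial. -/
def PolyTimeDecidable {α Γ : Type} (enc : α → List Γ) (promise P : α → Prop) : Prop :=
  ∃ f : {a : α // promise a} → Bool, (∀ a, f a = true ↔ P a.1) ∧
    ∃ M : Turing.TM2ComputableInPolyTime
        (fun a : {a : α // promise a} => enc a.1) Computability.encodeBool f,
      ∀ k, Finite (M.tm.Γ k)

end ReadOnce

/-! Call a variable big if its clause in `C` has at least two variables. Suppose a conjunction `d`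
of `D` uses only variables of `C` and exactly one of them, `x`, is big. If `C` holds and `x` is
true, then the one-variable clauses make the rest of `d` true, so `D` holds. Hence `x` can be
deleted from its clause without changing `C ∨ D` (`Represents.removeForced`). Unit propagation
repeats this. If a clause becomes empty, or some conjunction consists only of variables of
one-variable clauses, then `C` implies `D` and the function is that of `D`, which is read-once
(`Represents.eval_of_conflict`).

Otherwise propagation stops at a pair where every conjunction has a variable outside `C` or at least
two big ones. For such a pair, `C ∨ D` is read-once iff every conjunction meets all clauses or none.
If the condition holds, a conjunction meeting all clauses implies `C` and can be dropped, and the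
others share no variable with `C`. For the converse, a true point and a false point of a read-once
function have at most one common critical variable (`IsReadOnce.eq_of_critical`). Hall's theorem
gives a minimal true set, namely a transversal of the clauses through a prescribed variable that
includes no conjunction (`exists_transversal`). A conjunction that meets one clause and misses
another gives a false point sharing two critical variables with such a set
(`all_or_none_of_isReadOnceFunction`).

The algorithm needs only the numbers `|d ∩ c|` capped at two and one bit per `d` telling whether `d`
leaves `C`: every variable of `C` occurs exactly once in `D`, so the clause sizes are column sums of
this matrix (`colSums_matrix`). A conflict-free round that changes something switches on the bit of
some row, so `|D| + 1` rounds suffice (`exists_of_rounds`). The procedure is written in a small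
imperative language over stacks with counted steps, which is compiled to Turing machines
(`Exec.reachesIn`). -/

namespace ReadOnce

/-! ### A stack language with time bounds and its compilation to multi-stack machines -/

/-- Structured programs over finitely many stacks, with a register of type `ρ`. -/
inductive Cmd (K : Type) (Γ : K → Type) (ρ : Type) : Type
  | skip : Cmd K Γ ρ
  | set (f : ρ → ρ) : Cmd K Γ ρ
  | push (k : K) (a : Γ k) : Cmd K Γ ρ
  | pop (k : K) (c : Option (Γ k) → Cmd K Γ ρ) : Cmd K Γ ρ
  | read (c : ρ → Cmd K Γ ρ) : Cmd K Γ ρ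
  | seq (c d : Cmd K Γ ρ) : Cmd K Γ ρ
  | loop (k : K) (b : Γ k → Cmd K Γ ρ) : Cmd K Γ ρ

namespace Cmd

variable {K : Type} {Γ : K → Type} {ρ : Type}

/-- The control points of a program. -/
def Label : Cmd K Γ ρ → Type
  | skip => Unit
  | set _ => Unit
  | push _ _ => Unit
  | pop _ c => Option (Σ o, (c o).Label)
  | read c => Option (Σ r, (c r).Label)
  | seq c d => c.Label ⊕ d.Label
  | loop _ b => Option (Σ a, (b a).Label)

/-- The control point at which a program starts. -/
def entry : (c : Cmd K Γ ρ) → c.Label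
  | skip => ()
  | set _ => ()
  | push _ _ => ()
  | pop _ _ => none
  | read _ => none
  | seq c _ => Sum.inl c.entry
  | loop _ _ => none

theorem finite_label [Finite ρ] [∀ k, Finite (Γ k)] (c : Cmd K Γ ρ) : Finite c.Label := by
  induction c with
  | skip => exact inferInstanceAs (Finite Unit)
  | set _ => exact inferInstanceAs (Finite Unit)
  | push _ _ => exact inferInstanceAs (Finite Unit)
  | pop k c ih => exact inferInstanceAs (Finite (Option (Σ o, (c o).Label)))
  | read c ih => exact inferInstanceAs (Finite (Option (Σ r, (c r).Label)))
  | seq c d ihc ihd => exact inferInstanceAs (Finite (c.Label ⊕ d.Label))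
  | loop k b ih => exact inferInstanceAs (Finite (Option (Σ a, (b a).Label)))

/-- The internal states of the compiled machine: the register and, for every stack, the result of
the last pop. -/
abbrev Memory (Γ : K → Type) (ρ : Type) : Type := ρ × ∀ k, Option (Γ k)

variable [DecidableEq K]

open Turing in
/-- The statements of the machine that executes a program: `emb` names the control points of the
program, and `exit` is the label to jump to at the end. -/
def compile {Λ : Type} :
    (c : Cmd K Γ ρ) → (c.Label → Λ) → Λ → c.Label → TM2.Stmt Γ Λ (Memory Γ ρ)
  | skip, _, exit, _ => .goto fun _ => exit
  | set f, _, exit, _ => .load (fun v => (f v.1, v.2)) (.goto fun _ => exit)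
  | push k a, _, exit, _ => .push k (fun _ => a) (.goto fun _ => exit)
  | pop k c, emb, _, none =>
      .pop k (fun v o => (v.1, Function.update v.2 k o))
        (.goto fun v => emb (some ⟨v.2 k, (c (v.2 k)).entry⟩))
  | pop _ c, emb, exit, some ⟨o, l⟩ => (c o).compile (fun l => emb (some ⟨o, l⟩)) exit l
  | read c, emb, _, none => .goto fun v => emb (some ⟨v.1, (c v.1).entry⟩)
  | read c, emb, exit, some ⟨r, l⟩ => (c r).compile (fun l => emb (some ⟨r, l⟩)) exit l
  | seq c d, emb, _, Sum.inl l => c.compile (fun l => emb (Sum.inl l)) (emb (Sum.inr d.entry)) l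
  | seq _ d, emb, exit, Sum.inr l => d.compile (fun l => emb (Sum.inr l)) exit l
  | loop k b, emb, exit, none =>
      .pop k (fun v o => (v.1, Function.update v.2 k o))
        (.goto fun v => (v.2 k).elim exit fun a => emb (some ⟨a, (b a).entry⟩))
  | loop _ b, emb, _, some ⟨a, l⟩ => (b a).compile (fun l => emb (some ⟨a, l⟩)) (emb none) l

/-- `Exec c s s' t`: the program `c`, started in `s`, ends in `s'` after at most `t` steps. -/
inductive Exec :
    Cmd K Γ ρ → ρ × (∀ k, List (Γ k)) → ρ × (∀ k, List (Γ k)) → ℕ → Prop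
  | skip {s} : Exec skip s s 1
  | set {f r S} : Exec (set f) (r, S) (f r, S) 1
  | push {k a r S} : Exec (push k a) (r, S) (r, Function.update S k (a :: S k)) 1
  | pop {k c r S s' t} :
      Exec (c (S k).head?) (r, Function.update S k (S k).tail) s' t → Exec (pop k c) (r, S) s' (t + 1)
  | read {c r S s' t} : Exec (c r) (r, S) s' t → Exec (read c) (r, S) s' (t + 1)
  | seq {c d s s' s'' t t'} : Exec c s s' t → Exec d s' s'' t' → Exec (seq c d) s s'' (t + t')
  | loop_nil {k b r S} : S k = [] → Exec (loop k b) (r, S) (r, S) 1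
  | loop_cons {k b r S a l s' s'' t t'} : S k = a :: l →
      Exec (b a) (r, Function.update S k l) s' t → Exec (loop k b) s' s'' t' →
      Exec (loop k b) (r, S) s'' (t + t' + 1)
  | mono {c s s' t t'} : Exec c s s' t → t ≤ t' → Exec c s s' t'

/-- The machine with the statements `m` goes from `a` to `b` in at most `t` steps. -/
def ReachesIn {Λ σ : Type} (m : Λ → Turing.TM2.Stmt Γ Λ σ) (a b : Turing.TM2.Cfg Γ Λ σ) (t : ℕ) :
    Prop :=
  ∃ n ≤ t, (flip bind (Turing.TM2.step m))^[n] (some a) = some b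

omit [DecidableEq K] in
theorem iterate_bind_trans {σ : Type} {f : σ → Option σ} {a b : σ} {c : Option σ} {n n' : ℕ}
    (h : (flip bind f)^[n] (some a) = some b) (h' : (flip bind f)^[n'] (some b) = c) :
    (flip bind f)^[n + n'] (some a) = c := by
  rw [Nat.add_comm, Function.iterate_add_apply, h, h']

section Reaches

variable {Λ σ : Type} {m : Λ → Turing.TM2.Stmt Γ Λ σ} {a b c : Turing.TM2.Cfg Γ Λ σ} {t t' : ℕ}

theorem ReachesIn.trans (h : ReachesIn m a b t) (h' : ReachesIn m b c t') :
    ReachesIn m a c (t + t') := by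
  obtain ⟨n, hn, e⟩ := h
  obtain ⟨n', hn', e'⟩ := h'
  exact ⟨n + n', by omega, iterate_bind_trans e e'⟩

theorem ReachesIn.single (h : Turing.TM2.step m a = some b) : ReachesIn m a b 1 :=
  ⟨1, le_rfl, h⟩

theorem ReachesIn.mono (h : ReachesIn m a b t) (ht : t ≤ t') : ReachesIn m a b t' := by
  obtain ⟨n, hn, e⟩ := h
  exact ⟨n, hn.trans ht, e⟩

end Reaches

/-- Each pop overwrites its component of the memory before the next jump reads it. The old memory
`w` is therefore irrelevant, and quantifying over it lets the induction compose consecutive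
programs. -/
theorem Exec.reachesIn {Λ : Type} {m : Λ → Turing.TM2.Stmt Γ Λ (Memory Γ ρ)} {c : Cmd K Γ ρ}
    {s s' : ρ × (∀ k, List (Γ k))} {t : ℕ} (h : Exec c s s' t) :
    ∀ (emb : c.Label → Λ) (exit : Λ), (∀ l, m (emb l) = c.compile emb exit l) → ∀ w, ∃ w',
      ReachesIn m ⟨some (emb c.entry), (s.1, w), s.2⟩ ⟨some exit, (s'.1, w'), s'.2⟩ t := by
  have step {l : Λ} {q : Turing.TM2.Stmt Γ Λ (Memory Γ ρ)} {v S b} (hl : m l = q)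
      (hb : Turing.TM2.stepAux q v S = b) : ReachesIn m ⟨some l, v, S⟩ b 1 :=
    .single (by simp [Turing.TM2.step, hl, hb])
  induction h with
  | skip => exact fun emb exit hm w => ⟨w, step (hm ()) rfl⟩
  | set => exact fun emb exit hm w => ⟨w, step (hm ()) rfl⟩
  | push => exact fun emb exit hm w => ⟨w, step (hm ()) rfl⟩
  | @pop k c r S s' t h ih =>
    intro emb exit hm w
    obtain ⟨w', hw⟩ := ih (fun l => emb (some ⟨_, l⟩)) exit (fun l => hm (some ⟨_, l⟩))
      (Function.update w k (S k).head?)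
    refine ⟨w', (ReachesIn.trans (step (hm none) ?_) hw).mono (by omega)⟩
    simp only [compile, Turing.TM2.stepAux, Turing.TM2.Cfg.mk.injEq, Option.some.injEq, and_true]
    exact congrArg (fun o => emb (some ⟨o, (c o).entry⟩)) (Function.update_self _ _ _)
  | @read c r S s' t h ih =>
    intro emb exit hm w
    obtain ⟨w', hw⟩ := ih (fun l => emb (some ⟨_, l⟩)) exit (fun l => hm (some ⟨_, l⟩)) w
    refine ⟨w', (ReachesIn.trans (step (hm none) ?_) hw).mono (by omega)⟩
    rfl
  | @seq c d s s' s'' t t' h h' ih ih' =>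
    intro emb exit hm w
    obtain ⟨w', hw⟩ := ih (fun l => emb (Sum.inl l)) (emb (Sum.inr d.entry))
      (fun l => hm (Sum.inl l)) w
    obtain ⟨w'', hw'⟩ := ih' (fun l => emb (Sum.inr l)) exit (fun l => hm (Sum.inr l)) w'
    exact ⟨w'', hw.trans hw'⟩
  | @loop_nil k b r S hS =>
    intro emb exit hm w
    refine ⟨Function.update w k none, step (hm none) ?_⟩
    have : Function.update S k [] = S := by rw [← hS, Function.update_eq_self]
    simp [compile, hS, this]
  | @loop_cons k b r S a l s' s'' t t' hS h h' ih ih' =>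
    intro emb exit hm w
    obtain ⟨w', hw⟩ := ih (fun l => emb (some ⟨_, l⟩)) (emb none) (fun l => hm (some ⟨_, l⟩))
      (Function.update w k (some a))
    obtain ⟨w'', hw'⟩ := ih' emb exit hm w'
    refine ⟨w'', (ReachesIn.trans (step (hm none) ?_) (hw.trans hw')).mono (by omega)⟩
    simp [compile, hS]
  | mono h ht ih =>
    intro emb exit hm w
    obtain ⟨w', hw⟩ := ih emb exit hm w
    exact ⟨w', hw.mono ht⟩

/-- `Iter k b T p s s'`: if the stack `k` starts with `p` in the state `s`, then the passes of
`loop k b` over `p` lead to `s'`, and each of them takes at most `T` steps. -/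
inductive Iter (k : K) (b : Γ k → Cmd K Γ ρ) (T : ℕ) :
    List (Γ k) → ρ × (∀ k, List (Γ k)) → ρ × (∀ k, List (Γ k)) → Prop
  | nil {s} : Iter k b T [] s s
  | cons {a p l r S s' s''} : S k = a :: l → Exec (b a) (r, Function.update S k l) s' T →
      Iter k b T p s' s'' → Iter k b T (a :: p) (r, S) s''

/-- With this, the analysis of a loop can follow the way an encoded word is concatenated from its
pieces; `Iter.exec` turns the result into a run once the stack is exhausted. -/
theorem Iter.append {k : K} {b : Γ k → Cmd K Γ ρ} {T : ℕ} {p q : List (Γ k)}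
    {s s' s'' : ρ × (∀ k, List (Γ k))} (h : Iter k b T p s s') (h' : Iter k b T q s' s'') :
    Iter k b T (p ++ q) s s'' := by
  induction h with
  | nil => exact h'
  | cons e h _ ih => exact .cons e h (ih h')

/-- Each pass costs one extra step for the pop of the loop, and one last step finds the stack empty.
-/
theorem Iter.exec {k : K} {b : Γ k → Cmd K Γ ρ} {T : ℕ} {p : List (Γ k)}
    {s s' : ρ × (∀ k, List (Γ k))} (h : Iter k b T p s s') (hs : s'.2 k = []) :
    Exec (loop k b) s s' (p.length * (T + 1) + 1) := by
  induction h with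
  | nil => exact (Exec.loop_nil hs).mono (by omega)
  | cons e h _ ih =>
    refine (Exec.loop_cons e h (ih hs)).mono ?_
    rw [List.length_cons, Nat.add_mul]
    omega

open Turing in
/-- The machine that executes a program and resets its register at the end. -/
noncomputable def machine [Fintype K] [Finite ρ] [∀ k, Finite (Γ k)] (c : Cmd K Γ ρ) (r : ρ)
    (k₀ k₁ : K) : FinTM2 :=
  haveI := c.finite_label
  { K := K
    k₀ := k₀
    k₁ := k₁
    Γ := Γ
    Λ := Option c.Label
    main := some c.entry
    ΛFin := Fintype.ofFinite _
    σ := Memory Γ ρ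
    initialState := (r, fun _ => none)
    σFin := Fintype.ofFinite _
    Γk₀Fin := Fintype.ofFinite _
    m := fun
      -- `haltList` prescribes the initial internal state, so one more label restores it; this is
      -- the extra step in `Exec.outputs`.
      | none => .load (fun _ => (r, fun _ => none)) .halt
      | some l => c.compile some none l }

theorem initList_stk (tm : Turing.FinTM2) (l : List (tm.Γ tm.k₀)) :
    (Turing.initList tm l).stk = Function.update (fun _ => []) tm.k₀ l := by
  funext k
  by_cases hk : k = tm.k₀
  · subst hk
    simp [Turing.initList]
  · simp [Turing.initList, hk]

theorem haltList_stk (tm : Turing.FinTM2) (l : List (tm.Γ tm.k₁)) :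
    (Turing.haltList tm l).stk = Function.update (fun _ => []) tm.k₁ l := by
  funext k
  by_cases hk : k = tm.k₁
  · subst hk
    simp [Turing.haltList]
  · simp [Turing.haltList, hk]

theorem Exec.outputs [Fintype K] [Finite ρ] [∀ k, Finite (Γ k)] {c : Cmd K Γ ρ} {r r' : ρ}
    {k₀ k₁ : K} {l : List (Γ k₀)} {l' : List (Γ k₁)} {t : ℕ}
    (h : Exec c (r, Function.update (fun _ => []) k₀ l) (r', Function.update (fun _ => []) k₁ l') t) :
    Nonempty (Turing.TM2OutputsInTime (c.machine r k₀ k₁) l (some l') (t + 1)) := by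
  have hm : ∀ o, (c.machine r k₀ k₁).m (some o) = c.compile some none o := fun o => rfl
  obtain ⟨w, n, hn, e⟩ := h.reachesIn some none hm (fun _ => none)
  have hi : Turing.initList (c.machine r k₀ k₁) l =
      (⟨some (some c.entry), (r, fun _ => none), Function.update (fun _ => []) k₀ l⟩ :
        Turing.TM2.Cfg Γ (Option c.Label) (Memory Γ ρ)) :=
    congrArg (Turing.TM2.Cfg.mk _ _) (initList_stk (c.machine r k₀ k₁) l)
  have ho : Turing.haltList (c.machine r k₀ k₁) l' =
      (⟨none, (r, fun _ => none), Function.update (fun _ => []) k₁ l'⟩ :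
        Turing.TM2.Cfg Γ (Option c.Label) (Memory Γ ρ)) :=
    congrArg (Turing.TM2.Cfg.mk _ _) (haltList_stk (c.machine r k₀ k₁) l')
  have key : (flip bind (c.machine r k₀ k₁).step)^[n + 1]
      (some (Turing.initList (c.machine r k₀ k₁) l)) =
        some (Turing.haltList (c.machine r k₀ k₁) l') := by
    rw [ho, hi]
    exact iterate_bind_trans (n' := 1) e rfl
  exact ⟨⟨⟨n + 1, key⟩, Nat.succ_le_succ hn⟩⟩

end Cmd

end ReadOnce

namespace ReadOnce

/-! ### Read-once formulas, critical variables, and formulas for CNFs and DNFs -/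

namespace MonotoneFormula

theorem eval_update_of_occurrences_eq_zero {φ : MonotoneFormula} {x : ℕ}
    (h : φ.occurrences x = 0) (v : ℕ → Bool) (b : Bool) :
    φ.eval (Function.update v x b) = φ.eval v := by
  induction φ with
  | var y =>
    simp only [occurrences] at h
    have : y ≠ x := by
      rintro rfl
      simp at h
    simp [eval, this]
  | and φ ψ ihφ ihψ =>
    simp only [occurrences, Nat.add_eq_zero_iff] at h
    simp [eval, ihφ h.1, ihψ h.2]
  | or φ ψ ihφ ihψ =>
    simp only [occurrences, Nat.add_eq_zero_iff] at h
    simp [eval, ihφ h.1, ihψ h.2]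

/-- In a read-once formula, two variables that are both critical for some true value cannot both be
critical for some false value. -/
theorem IsReadOnce.eq_of_critical {φ : MonotoneFormula} (h : φ.IsReadOnce) {x y : ℕ}
    {p q : ℕ → Bool} (hp : φ.eval p = true) (hpx : φ.eval (Function.update p x false) = false)
    (hpy : φ.eval (Function.update p y false) = false) (hq : φ.eval q = false)
    (hqx : φ.eval (Function.update q x true) = true)
    (hqy : φ.eval (Function.update q y true) = true) : x = y := by
  -- A variable occurs in at most one of the two subformulas, so the value of the other one ignores
  -- it.
  have key {φ ψ : MonotoneFormula} (h : ∀ x, φ.occurrences x + ψ.occurrences x ≤ 1) (x : ℕ) :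
      (∀ v b, φ.eval (Function.update v x b) = φ.eval v) ∨
        ∀ v b, ψ.eval (Function.update v x b) = ψ.eval v := by
    rcases Nat.eq_zero_or_pos (φ.occurrences x) with h0 | h0
    · exact .inl (eval_update_of_occurrences_eq_zero h0)
    · exact .inr (eval_update_of_occurrences_eq_zero (by have := h x; omega))
  induction φ with
  | var z =>
    have aux {w : ℕ} (hw : eval (Function.update p w false) (var z) = false) : z = w := by
      by_contra hne
      simp only [eval, Function.update_of_ne hne] at hw hp
      simp [hw] at hp
    exact (aux hpx).symm.trans (aux hpy)
  | and φ ψ ihφ ihψ =>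
    have hφ : φ.IsReadOnce := fun z => le_trans (Nat.le_add_right _ _) (h z)
    have hψ : ψ.IsReadOnce := fun z => le_trans (Nat.le_add_left _ _) (h z)
    simp only [eval, Bool.and_eq_true, Bool.and_eq_false_iff] at hp hpx hpy hq hqx hqy
    -- At the false point `q`, flipping one variable repairs the conjunction, so exactly one
    -- conjunct is false there and both `x` and `y` must act on it. At `p` both conjuncts are true,
    -- so `x` and `y` are critical for that same conjunct, and induction applies. The case `or` is
    -- dual, with the roles of `p` and `q` exchanged.
    rcases key h x with hx | hx <;> rcases key h y with hy | hy <;> simp_all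
  | or φ ψ ihφ ihψ =>
    have hφ : φ.IsReadOnce := fun z => le_trans (Nat.le_add_right _ _) (h z)
    have hψ : ψ.IsReadOnce := fun z => le_trans (Nat.le_add_left _ _) (h z)
    simp only [eval, Bool.or_eq_true, Bool.or_eq_false_iff] at hp hpx hpy hq hqx hqy
    rcases key h x with hx | hx <;> rcases key h y with hy | hy <;> simp_all

/-- The conjunction of a non-empty list of formulas. -/
def conj : List MonotoneFormula → MonotoneFormula
  -- A junk value, since constants are not formulas; the lemmas below assume a non-empty list.
  | [] => var 0
  | [φ] => φ
  | φ :: ψ :: l => and φ (conj (ψ :: l))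

/-- The disjunction of a non-empty list of formulas. -/
def disj : List MonotoneFormula → MonotoneFormula
  | [] => var 0
  | [φ] => φ
  | φ :: ψ :: l => or φ (disj (ψ :: l))

theorem eval_conj (v : ℕ → Bool) :
    ∀ l : List MonotoneFormula, l ≠ [] → (conj l).eval v = l.all (eval v)
  | [φ], _ => by simp [conj]
  | φ :: ψ :: l, _ => by simp [conj, eval, eval_conj v (ψ :: l)]

theorem eval_disj (v : ℕ → Bool) :
    ∀ l : List MonotoneFormula, l ≠ [] → (disj l).eval v = l.any (eval v)
  | [φ], _ => by simp [disj]
  | φ :: ψ :: l, _ => by simp [disj, eval, eval_disj v (ψ :: l)]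

theorem occurrences_conj (x : ℕ) : ∀ l : List MonotoneFormula, l ≠ [] →
    (conj l).occurrences x = (l.map (occurrences x)).sum
  | [φ], _ => by simp [conj]
  | φ :: ψ :: l, _ => by simp [conj, occurrences, occurrences_conj x (ψ :: l)]

theorem occurrences_disj (x : ℕ) : ∀ l : List MonotoneFormula, l ≠ [] →
    (disj l).occurrences x = (l.map (occurrences x)).sum
  | [φ], _ => by simp [disj]
  | φ :: ψ :: l, _ => by simp [disj, occurrences, occurrences_disj x (ψ :: l)]

theorem sum_map_occurrences_var (x : ℕ) (c : List ℕ) :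
    ((c.map var).map (occurrences x)).sum = c.count x := by
  induction c with
  | nil => rfl
  | cons y c ih =>
    rw [List.map_cons, List.map_cons, List.sum_cons, ih, List.count_cons]
    simp only [occurrences, beq_iff_eq]
    omega

end MonotoneFormula

namespace Groups

open MonotoneFormula

variable {L : Groups}

/-- The formula that a list of clauses stands for. -/
def toCNF (L : Groups) : MonotoneFormula :=
  conj (L.map fun c => disj (c.map var))

/-- The formula that a list of conjunctions stands for. -/
def toDNF (L : Groups) : MonotoneFormula :=
  disj (L.map fun c => conj (c.map var))

theorem IsFormula.eval_toCNF (h : L.IsFormula) (v : ℕ → Bool) : L.toCNF.eval v = L.evalCNF v := by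
  rw [toCNF, eval_conj _ _ (by simpa using h.1), evalCNF, List.all_map, Bool.eq_iff_iff,
    List.all_eq_true, List.all_eq_true]
  refine forall₂_congr fun c hc => ?_
  simp only [Function.comp_apply]
  rw [eval_disj _ _ (by simpa using h.2 c hc), List.any_map]
  rfl

theorem IsFormula.eval_toDNF (h : L.IsFormula) (v : ℕ → Bool) : L.toDNF.eval v = L.evalDNF v := by
  rw [toDNF, eval_disj _ _ (by simpa using h.1), evalDNF, List.any_map, Bool.eq_iff_iff,
    List.any_eq_true, List.any_eq_true]
  refine exists_congr fun c => and_congr_right fun hc => ?_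
  simp only [Function.comp_apply]
  rw [eval_conj _ _ (by simpa using h.2 c hc), List.all_map]
  rfl

theorem IsFormula.occurrences_toCNF (h : L.IsFormula) (x : ℕ) :
    L.toCNF.occurrences x = L.flatten.count x := by
  rw [toCNF, occurrences_conj _ _ (by simpa using h.1), List.count_flatten, List.map_map]
  congr 1
  refine List.map_congr_left fun c hc => ?_
  simp only [Function.comp_apply]
  rw [occurrences_disj _ _ (by simpa using h.2 c hc), sum_map_occurrences_var]

theorem IsFormula.occurrences_toDNF (h : L.IsFormula) (x : ℕ) :
    L.toDNF.occurrences x = L.flatten.count x := by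
  rw [toDNF, occurrences_disj _ _ (by simpa using h.1), List.count_flatten, List.map_map]
  congr 1
  refine List.map_congr_left fun c hc => ?_
  simp only [Function.comp_apply]
  rw [occurrences_conj _ _ (by simpa using h.2 c hc), sum_map_occurrences_var]

theorem IsFormula.isReadOnceFunction_evalCNF (h : L.IsFormula) (h' : L.IsReadOnce) :
    IsReadOnceFunction L.evalCNF :=
  ⟨L.toCNF, fun x => (h.occurrences_toCNF x).trans_le (h' x), h.eval_toCNF⟩

theorem IsFormula.isReadOnceFunction_evalDNF (h : L.IsFormula) (h' : L.IsReadOnce) :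
    IsReadOnceFunction L.evalDNF :=
  ⟨L.toDNF, fun x => (h.occurrences_toDNF x).trans_le (h' x), h.eval_toDNF⟩

theorem isReadOnce_iff_nodup : L.IsReadOnce ↔ L.flatten.Nodup :=
  List.nodup_iff_count_le_one.symm

theorem IsReadOnce.nodup (h : L.IsReadOnce) {c : List ℕ} (hc : c ∈ L) : c.Nodup :=
  (List.nodup_flatten.1 (isReadOnce_iff_nodup.1 h)).1 c hc

theorem IsReadOnce.group_unique (h : L.IsReadOnce) {c c' : List ℕ} (hc : c ∈ L) (hc' : c' ∈ L)
    {x : ℕ} (hx : x ∈ c) (hx' : x ∈ c') : c = c' := by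
  by_contra hne
  have : Std.Symm (List.Disjoint (α := ℕ)) := ⟨fun _ _ h => h.symm⟩
  exact (List.nodup_flatten.1 (isReadOnce_iff_nodup.1 h)).2.forall hc hc' hne hx hx'

theorem evalCNF_eq_true {v : ℕ → Bool} : L.evalCNF v = true ↔ ∀ c ∈ L, ∃ x ∈ c, v x = true := by
  simp [evalCNF]

theorem evalDNF_eq_true {v : ℕ → Bool} : L.evalDNF v = true ↔ ∃ d ∈ L, ∀ x ∈ d, v x = true := by
  simp [evalDNF]

theorem evalCNF_eq_false {v : ℕ → Bool} :
    L.evalCNF v = false ↔ ∃ c ∈ L, ∀ x ∈ c, v x = false := by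
  simp [evalCNF]

theorem evalDNF_eq_false {v : ℕ → Bool} :
    L.evalDNF v = false ↔ ∀ d ∈ L, ∃ x ∈ d, v x = false := by
  simp [evalDNF]

end Groups

/-! ### The criterion for pairs on which unit propagation has stopped -/

section Criterion

open Groups

variable {C D : Groups}

/-- A true conjunction that meets every clause makes `C` true, so it is redundant. The remaining
conjunctions `D₀` are disjoint from `C`, so the expression `C ∨ D₀` is itself read-once; if `D₀` is
empty, `C` alone computes the function. -/
theorem isReadOnceFunction_of_all_or_none (hC : C.IsFormula) (hC' : C.IsReadOnce)
    (hD : D.IsFormula) (hD' : D.IsReadOnce)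
    (h : ∀ d ∈ D, (∀ c ∈ C, ∃ x ∈ c, x ∈ d) ∨ ∀ c ∈ C, ∀ x ∈ c, x ∉ d) :
    IsReadOnceFunction fun v => C.evalCNF v || D.evalDNF v := by
  classical
  set D₀ : Groups := D.filter fun d => ∀ c ∈ C, ∀ x ∈ c, x ∉ d with hD₀
  have mem {d} : d ∈ D₀ ↔ d ∈ D ∧ ∀ c ∈ C, ∀ x ∈ c, x ∉ d := by simp [D₀]
  have heval (v) : (C.evalCNF v || D.evalDNF v) = (C.evalCNF v || D₀.evalDNF v) := by
    rw [Bool.eq_iff_iff, Bool.or_eq_true, Bool.or_eq_true, evalDNF_eq_true, evalDNF_eq_true]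
    refine ⟨?_, Or.imp_right fun ⟨d, hd, hv⟩ => ⟨d, (mem.1 hd).1, hv⟩⟩
    rintro (hv | ⟨d, hd, hv⟩)
    · exact .inl hv
    · rcases h d hd with h | h
      · refine .inl (evalCNF_eq_true.2 fun c hc => ?_)
        obtain ⟨x, hx, hx'⟩ := h c hc
        exact ⟨x, hx, hv x hx'⟩
      · exact .inr ⟨d, mem.2 ⟨hd, h⟩, hv⟩
  have hcount (x) : D₀.flatten.count x ≤ D.flatten.count x :=
    (List.Sublist.flatten List.filter_sublist).count_le x
  simp only [heval]
  by_cases h0 : D₀ = []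
  · simpa [h0, evalDNF] using hC.isReadOnceFunction_evalCNF hC'
  have hF : IsFormula D₀ := ⟨h0, fun d hd => hD.2 d (mem.1 hd).1⟩
  refine ⟨.or C.toCNF (toDNF D₀), fun x => ?_, fun v => ?_⟩
  · simp only [MonotoneFormula.occurrences, hC.occurrences_toCNF, hF.occurrences_toDNF]
    by_cases hx : x ∈ C.flatten
    · have : x ∉ D₀.flatten := by
        rw [List.mem_flatten] at hx ⊢
        rintro ⟨d, hd, hxd⟩
        obtain ⟨c, hc, hxc⟩ := hx
        exact (mem.1 hd).2 c hc x hxc hxd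
      rw [List.count_eq_zero_of_not_mem this]
      exact hC' x
    · rw [List.count_eq_zero_of_not_mem hx, Nat.zero_add]
      exact (hcount x).trans (hD' x)
  · simp [MonotoneFormula.eval, hC.eval_toCNF, hF.eval_toDNF]

/-- `x` belongs to a clause with at least two variables. -/
def Big (C : Groups) (x : ℕ) : Prop :=
  ∃ c ∈ C, x ∈ c ∧ 2 ≤ c.length

theorem eq_of_length_lt_two {l : List ℕ} (hl : l.length < 2) {x y : ℕ} (hx : x ∈ l) (hy : y ∈ l) :
    x = y := by
  match l, hl, hx, hy with
  | [z], _, hx, hy => exact (List.mem_singleton.1 hx).trans (List.mem_singleton.1 hy).symm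

theorem exists_mem_ne {l : List ℕ} (h : l.Nodup) (hl : 2 ≤ l.length) (y : ℕ) : ∃ w ∈ l, w ≠ y := by
  by_contra hcon
  push Not at hcon
  have hs : l.toFinset ⊆ {y} := fun z hz =>
    Finset.mem_singleton.2 (hcon z (List.mem_toFinset.1 hz))
  have := Finset.card_le_card hs
  rw [Finset.card_singleton, List.toFinset_card_of_nodup h] at this
  omega

/-- Counting for Hall's condition: `hd` makes the sets pairwise disjoint. -/
theorem two_mul_card_le_card_biUnion {ι : Type*} {s : Finset ι} {t : ι → Finset ℕ}
    (ht : ∀ i ∈ s, 2 ≤ (t i).card)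
    (hd : ∀ i ∈ s, ∀ j ∈ s, ∀ x, x ∈ t i → x ∈ t j → i = j) :
    2 * s.card ≤ (s.biUnion t).card := by
  rw [Finset.card_biUnion, Nat.mul_comm, ← smul_eq_mul]
  · exact Finset.card_nsmul_le_sum _ _ _ ht
  · intro i hi j hj hne
    exact Finset.disjoint_left.2 fun x hx hx' => hne (hd i hi j hj x hx hx')

open Classical in
/-- There is a set that contains a given variable of `C`, has exactly one variable of every clause
and includes no conjunction of `D`. -/
theorem exists_transversal (hC : ∀ c ∈ C, c ≠ []) (hC' : C.IsReadOnce) (hD' : D.IsReadOnce)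
    (hst : ∀ d ∈ D, (∃ x ∈ d, ∀ c ∈ C, x ∉ c) ∨ 2 ≤ (d.filter fun x => Big C x).length)
    {c₀ : List ℕ} (hc₀ : c₀ ∈ C) {y : ℕ} (hy : y ∈ c₀) :
    ∃ P : ℕ → Prop, P y ∧ (∀ c ∈ C, ∃ x ∈ c, P x) ∧
      (∀ c ∈ C, ∀ x ∈ c, ∀ x' ∈ c, P x → P x' → x = x') ∧ ∀ d ∈ D, ∃ x ∈ d, ¬ P x := by
  -- The instance of Hall's theorem: every clause with at least two variables, except `c₀`, selects
  -- a variable to be put into `P`, and every conjunction inside the variables of `C` selects a big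
  -- variable other than `y` to be kept out of `P`.
  let t : {c // c ∈ C ∧ 2 ≤ c.length ∧ c ≠ c₀} ⊕ {d // d ∈ D ∧ ∀ x ∈ d, ∃ c ∈ C, x ∈ c} →
      Finset ℕ
    | .inl c => c.1.toFinset
    | .inr d => (d.1.filter fun x => Big C x).toFinset.erase y
  have hall : ∀ s : Finset _, s.card ≤ (s.biUnion t).card := by
    intro s
    have h1 : 2 * s.toLeft.card ≤ (s.biUnion t).card := by
      refine (two_mul_card_le_card_biUnion (t := fun c => c.1.toFinset) ?_ ?_).trans
        (Finset.card_le_card fun x hx => ?_)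
      · intro c _
        rw [List.toFinset_card_of_nodup (hC'.nodup c.2.1)]
        exact c.2.2.1
      · intro c _ c' _ x hx hx'
        exact Subtype.ext (hC'.group_unique c.2.1 c'.2.1 (List.mem_toFinset.1 hx)
          (List.mem_toFinset.1 hx'))
      · obtain ⟨c, hc, hx⟩ := Finset.mem_biUnion.1 hx
        exact Finset.mem_biUnion.2 ⟨.inl c, Finset.mem_toLeft.1 hc, hx⟩
    -- Removing `y` costs at most one element of the union. Together with `h1` this gives `2 |s| ≤ 2
    -- |⋃ t| + 1`, and parity absorbs the excess.
    have h2 : 2 * s.toRight.card ≤ (s.biUnion t).card + 1 := by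
      refine (two_mul_card_le_card_biUnion
        (t := fun d => (d.1.filter fun x => Big C x).toFinset) ?_ ?_).trans
        ((Finset.card_le_card fun x hx => ?_).trans (Finset.card_insert_le y _))
      · intro d _
        rw [List.toFinset_card_of_nodup ((hD'.nodup d.2.1).filter _)]
        rcases hst d.1 d.2.1 with ⟨x, hx, hx'⟩ | h
        · obtain ⟨c, hc, hxc⟩ := d.2.2 x hx
          exact absurd hxc (hx' c hc)
        · exact h
      · intro d _ d' _ x hx hx'
        exact Subtype.ext (hD'.group_unique d.2.1 d'.2.1
          (List.mem_of_mem_filter (List.mem_toFinset.1 hx))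
          (List.mem_of_mem_filter (List.mem_toFinset.1 hx')))
      · obtain ⟨d, hd, hx⟩ := Finset.mem_biUnion.1 hx
        rw [Finset.mem_insert, or_iff_not_imp_left]
        exact fun hne => Finset.mem_biUnion.2
          ⟨.inr d, Finset.mem_toRight.1 hd, Finset.mem_erase.2 ⟨hne, hx⟩⟩
    have h3 := s.card_toLeft_add_card_toRight
    omega
  obtain ⟨g, hg, hgt⟩ := (Finset.all_card_le_biUnion_card_iff_exists_injective t).1 hall
  have hgl (c) : g (.inl c) ∈ c.1 := List.mem_toFinset.1 (hgt (.inl c))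
  have hgr (d) : g (.inr d) ≠ y ∧ g (.inr d) ∈ d.1 ∧ Big C (g (.inr d)) := by
    have := Finset.mem_erase.1 (hgt (.inr d))
    simpa using this
  -- Injectivity of `g` separates variables selected by clauses from those selected by conjunctions.
  -- The latter are big and differ from `y`, so `P` omits them.
  let P : ℕ → Prop := fun x => x = y ∨ (∃ c, x = g (.inl c)) ∨ ∃ c ∈ C, c.length < 2 ∧ x ∈ c
  have hP {c x} (hc : c ∈ C) (hx : x ∈ c) (h : P x) :
      c.length < 2 ∨ c = c₀ ∧ x = y ∨ c ≠ c₀ ∧ ∃ hc, x = g (.inl ⟨c, hc⟩) := by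
    rcases h with rfl | ⟨c', rfl⟩ | ⟨c', hc', h, hx'⟩
    · exact .inr (.inl ⟨hC'.group_unique hc hc₀ hx hy, rfl⟩)
    · obtain rfl := hC'.group_unique hc c'.2.1 hx (hgl c')
      exact .inr (.inr ⟨c'.2.2.2, c'.2, rfl⟩)
    · obtain rfl := hC'.group_unique hc hc' hx hx'
      exact .inl h
  refine ⟨P, .inl rfl, fun c hc => ?_, fun c hc x hx x' hx' h h' => ?_, fun d hd => ?_⟩
  · by_cases hl : c.length < 2
    · obtain ⟨x, hx⟩ := List.exists_mem_of_ne_nil c (hC c hc)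
      exact ⟨x, hx, .inr (.inr ⟨c, hc, hl, hx⟩)⟩
    · by_cases hcc : c = c₀
      · exact ⟨y, hcc ▸ hy, .inl rfl⟩
      · exact ⟨_, hgl ⟨c, hc, by omega, hcc⟩, .inr (.inl ⟨_, rfl⟩)⟩
  · by_cases hl : c.length < 2
    · exact eq_of_length_lt_two hl hx hx'
    rcases (hP hc hx h).resolve_left hl with ⟨h1, h2⟩ | ⟨h1, _, h2⟩ <;>
      rcases (hP hc hx' h').resolve_left hl with ⟨h1', h2'⟩ | ⟨h1', _, h2'⟩
    · rw [h2, h2']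
    · exact absurd h1 h1'
    · exact absurd h1' h1
    · rw [h2, h2']
  · by_cases hdC : ∀ x ∈ d, ∃ c ∈ C, x ∈ c
    · obtain ⟨h1, h2, c, hc, hxc, hl⟩ := hgr ⟨d, hd, hdC⟩
      refine ⟨_, h2, fun h => ?_⟩
      rcases h with h | ⟨c', h⟩ | ⟨c', hc', hl', h⟩
      · exact h1 h
      · cases hg h
      · have := hC'.group_unique hc hc' hxc h
        subst this
        omega
    · push Not at hdC
      obtain ⟨x, hx, hxC⟩ := hdC
      refine ⟨x, hx, fun h => ?_⟩
      rcases h with rfl | ⟨c', rfl⟩ | ⟨c', hc', hl', h⟩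
      · exact hxC _ hc₀ hy
      · exact hxC _ c'.2.1 (hgl c')
      · exact hxC _ hc' h

-- Suppose `d` misses the clause `c` but contains `y ∈ c'`. A transversal `P` is a minimal true set,
-- so all of its variables in `C` are critical. It remains to find a false point with two critical
-- variables in `P`; the construction depends on whether `c'` has more than one variable.
open Classical in
theorem all_or_none_of_isReadOnceFunction (hC : ∀ c ∈ C, c ≠ []) (hC' : C.IsReadOnce)
    (hD : ∀ d ∈ D, d ≠ []) (hD' : D.IsReadOnce) (hCD : ∀ c ∈ C, ∀ x ∈ c, ∃ d ∈ D, x ∈ d)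
    (hst : ∀ d ∈ D, (∃ x ∈ d, ∀ c ∈ C, x ∉ c) ∨ 2 ≤ (d.filter fun x => Big C x).length)
    (h : IsReadOnceFunction fun v => C.evalCNF v || D.evalDNF v) :
    ∀ d ∈ D, (∀ c ∈ C, ∃ x ∈ c, x ∈ d) ∨ ∀ c ∈ C, ∀ x ∈ c, x ∉ d := by
  intro d hd
  by_contra hcon
  push Not at hcon
  obtain ⟨⟨c, hc, hcd⟩, c', hc', y, hyc', hyd⟩ := hcon
  obtain ⟨φ, hφ, hf⟩ := h
  have hcc' : c ≠ c' := by
    rintro rfl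
    exact hcd y hyc' hyd
  -- It suffices to find a transversal `P` and a set `Q` with two common critical variables.
  have key (P : ℕ → Prop) (hP : ∀ c ∈ C, ∃ x ∈ c, P x)
      (hP1 : ∀ c ∈ C, ∀ x ∈ c, ∀ x' ∈ c, P x → P x' → x = x') (hPD : ∀ d ∈ D, ∃ x ∈ d, ¬ P x)
      (q : ℕ → Bool) (hq : φ.eval q = false) (u v : ℕ) (hu : P u) (hv : P v)
      (huC : ∃ c ∈ C, u ∈ c) (hvC : ∃ c ∈ C, v ∈ c)
      (hqu : φ.eval (Function.update q u true) = true)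
      (hqv : φ.eval (Function.update q v true) = true) : u = v := by
    have hcrit {x} (hx : P x) (hxC : ∃ c ∈ C, x ∈ c) :
        φ.eval (Function.update (fun x => decide (P x)) x false) = false := by
      rw [hf, Bool.or_eq_false_iff, evalCNF_eq_false, evalDNF_eq_false]
      obtain ⟨c, hc, hxc⟩ := hxC
      refine ⟨⟨c, hc, fun z hz => ?_⟩, fun d hd => ?_⟩
      · rcases eq_or_ne z x with rfl | hne
        · simp
        · simp only [Function.update_of_ne hne, decide_eq_false_iff_not]
          exact fun h => hne (hP1 c hc z hz x hxc h hx)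
      · obtain ⟨z, hz, hzP⟩ := hPD d hd
        refine ⟨z, hz, ?_⟩
        rcases eq_or_ne z x with rfl | hne
        · simp
        · simp [Function.update_of_ne hne, hzP]
    refine hφ.eq_of_critical (p := fun x => decide (P x)) ?_ (hcrit hu huC) (hcrit hv hvC) hq hqu hqv
    rw [hf, Bool.or_eq_true, evalCNF_eq_true]
    exact .inl fun c hc => by simpa using hP c hc
  by_cases hl : 2 ≤ c'.length
  · obtain ⟨P, hPy, hP, hP1, hPD⟩ := exists_transversal hC hC' hD' hst hc' hyc'
    obtain ⟨w, hw, hwy⟩ := exists_mem_ne (hC'.nodup hc') hl y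
    have he (d') : ∃ z, d' ∈ D → z ∈ d' ∧ z ≠ w ∧ (d' = d → z = y) := by
      by_cases hd' : d' ∈ D
      swap
      · exact ⟨0, fun h => absurd h hd'⟩
      by_cases hdd : d' = d
      · exact ⟨y, fun _ => ⟨hdd ▸ hyd, hwy.symm, fun _ => rfl⟩⟩
      -- `w` can be avoided: a variable outside `C` differs from `w`, and two big variables leave a
      -- choice.
      · suffices ∃ z ∈ d', z ≠ w by
          obtain ⟨z, hz, hzw⟩ := this
          exact ⟨z, fun _ => ⟨hz, hzw, fun h => absurd h hdd⟩⟩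
        rcases hst d' hd' with ⟨x, hx, hxC⟩ | h2
        · exact ⟨x, hx, fun e => hxC c' hc' (e ▸ hw)⟩
        · exact exists_mem_ne (hD'.nodup hd') (h2.trans (List.length_filter_le _ _)) w
    choose e he using he
    -- Making `Q` false falsifies the clause `c` and every conjunction. By the choice of `e`, the
    -- only variable of `d` in `Q` is `y`, and `w ∉ Q`.
    let Q : Finset ℕ := c.toFinset ∪ D.toFinset.image e
    have hQ : φ.eval (fun x => decide (x ∉ Q)) = false := by
      rw [hf, Bool.or_eq_false_iff, evalCNF_eq_false, evalDNF_eq_false]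
      refine ⟨⟨c, hc, fun x hx => ?_⟩, fun d' hd' => ⟨e d', (he d' hd').1, ?_⟩⟩
      · simp [Q, hx]
      · simp only [decide_eq_false_iff_not, not_not, Q]
        exact Finset.mem_union_right _ (Finset.mem_image_of_mem _ (List.mem_toFinset.2 hd'))
    -- In a minimal false set every variable is critical. `R` must contain `y` to falsify `d`, and
    -- it includes a whole clause `c''`, which `P` meets in some `u`. Then `u = y` forces `c'' =
    -- c'`, hence `w ∈ R ⊆ Q`, which is impossible.
    obtain ⟨R, hRQ, hR⟩ := exists_minimal_le_of_wellFoundedLT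
      (fun R : Finset ℕ => φ.eval (fun x => decide (x ∉ R)) = false) Q hQ
    have hRf := hR.prop
    have hcrit {x} (hx : x ∈ R) :
        φ.eval (Function.update (fun x => decide (x ∉ R)) x true) = true := by
      have hlt : R.erase x < R := Finset.erase_ssubset hx
      have := hR.not_prop_of_lt hlt
      rw [Bool.not_eq_false] at this
      refine (congrArg (fun v => φ.eval v) (funext fun z => ?_)).trans this
      rcases eq_or_ne z x with rfl | hne
      · simp
      · simp [hne]
    have hQd {x} (hx : x ∈ d) (hxR : x ∈ R) : x = y := by
      rcases Finset.mem_union.1 (hRQ hxR) with h | h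
      · exact absurd hx (hcd x (List.mem_toFinset.1 h))
      · obtain ⟨d', hd', rfl⟩ := Finset.mem_image.1 h
        rw [List.mem_toFinset] at hd'
        exact (he d' hd').2.2 (hD'.group_unique hd' hd (he d' hd').1 hx)
    rw [hf, Bool.or_eq_false_iff, evalCNF_eq_false, evalDNF_eq_false] at hRf
    have hyR : y ∈ R := by
      obtain ⟨x, hx, hxR⟩ := hRf.2 d hd
      simp only [decide_eq_false_iff_not, not_not] at hxR
      exact hQd hx hxR ▸ hxR
    obtain ⟨c'', hc'', hcR⟩ := hRf.1
    simp only [decide_eq_false_iff_not, not_not] at hcR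
    obtain ⟨u, hu, hPu⟩ := hP c'' hc''
    have huy := key P hP hP1 hPD _ hR.prop u y hPu hPy ⟨c'', hc'', hu⟩ ⟨c', hc', hyc'⟩
      (hcrit (hcR u hu)) (hcrit hyR)
    subst huy
    obtain rfl := hC'.group_unique hc'' hc' hu hyc'
    rcases Finset.mem_union.1 (hRQ (hcR w hw)) with h | h
    · exact hcc' (hC'.group_unique hc hc'' (List.mem_toFinset.1 h) hw)
    · obtain ⟨d', hd', h⟩ := Finset.mem_image.1 h
      rw [List.mem_toFinset] at hd'
      exact (he d' hd').2.1 h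
  -- Here `c'` is just `y`, so every transversal contains `y`; one through some `u ∈ c` is taken,
  -- and `u` lies in a conjunction `d₁` other than `d`.
  · obtain ⟨u, huc⟩ := List.exists_mem_of_ne_nil c (hC c hc)
    obtain ⟨P, hPu, hP, hP1, hPD⟩ := exists_transversal hC hC' hD' hst hc huc
    obtain ⟨d₁, hd₁, hud₁⟩ := hCD c hc u huc
    have hdd : d₁ ≠ d := by
      rintro rfl
      exact hcd u huc hud₁
    have hc'y {x} (hx : x ∈ c') : x = y := eq_of_length_lt_two (not_le.1 hl) hx hyc'
    have hPy : P y := by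
      obtain ⟨x, hx, hPx⟩ := hP c' hc'
      exact hc'y hx ▸ hPx
    have he (d') : ∃ z, d' ∈ D → z ∈ d' ∧ (d' = d → z = y) ∧ (d' = d₁ → z = u) := by
      by_cases hd' : d' ∈ D
      swap
      · exact ⟨0, fun h => absurd h hd'⟩
      by_cases h1 : d' = d
      · exact ⟨y, fun _ => ⟨h1 ▸ hyd, fun _ => rfl, fun h => absurd (h.symm.trans h1) hdd⟩⟩
      by_cases h2 : d' = d₁
      · exact ⟨u, fun _ => ⟨h2 ▸ hud₁, fun h => absurd h h1, fun _ => rfl⟩⟩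
      obtain ⟨z, hz⟩ := List.exists_mem_of_ne_nil d' (hD d' hd')
      exact ⟨z, fun _ => ⟨hz, fun h => absurd h h1, fun h => absurd h h2⟩⟩
    choose e he using he
    -- Exactly one variable of each conjunction is false at `q`, so each of these is critical; among
    -- them are `y` for `d` and `u` for `d₁`. The clause `c'` is false because `y` is.
    let q : ℕ → Bool := fun x => decide (∀ d ∈ D, x ≠ e d)
    have hqe {d'} (hd' : d' ∈ D) : q (e d') = false := by
      simp only [q, decide_eq_false_iff_not]
      exact fun h => h d' hd' rfl
    have hed : e d = y := (he d hd).2.1 rfl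
    have hed₁ : e d₁ = u := (he d₁ hd₁).2.2 rfl
    have hcrit {d'} (hd' : d' ∈ D) : φ.eval (Function.update q (e d') true) = true := by
      rw [hf, Bool.or_eq_true, evalDNF_eq_true]
      refine .inr ⟨d', hd', fun x hx => ?_⟩
      rcases eq_or_ne x (e d') with rfl | hne
      · simp
      · simp only [Function.update_of_ne hne, q, decide_eq_true_eq]
        rintro d'' hd'' rfl
        exact hne (by rw [hD'.group_unique hd' hd'' hx (he d'' hd'').1])
    have huy := key P hP hP1 hPD q ?_ u y hPu hPy ⟨c, hc, huc⟩ ⟨c', hc', hyc'⟩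
      (hed₁ ▸ hcrit hd₁) (hed ▸ hcrit hd)
    · subst huy
      exact hcd u huc hyd
    · rw [hf, Bool.or_eq_false_iff, evalCNF_eq_false, evalDNF_eq_false]
      refine ⟨⟨c', hc', fun x hx => ?_⟩, fun d' hd' => ⟨e d', (he d' hd').1, hqe hd'⟩⟩
      rw [hc'y hx, ← hed]
      exact hqe hd

end Criterion

end ReadOnce

namespace ReadOnce

/-! ### Unit propagation on matrices with entries capped at two -/

/-- Numbers of variables, counted up to two. -/
inductive Cell where
  | zero : Cell
  | one : Cell
  | many : Cell
  deriving DecidableEq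

namespace Cell

instance : Fintype Cell :=
  ⟨{zero, one, many}, fun a => by cases a <;> simp⟩

/-- The cell that represents a number. -/
def sat : ℕ → Cell
  | 0 => zero
  | 1 => one
  | _ + 2 => many

/-- Saturating addition. -/
def add : Cell → Cell → Cell
  | zero, b => b
  | a, zero => a
  | _, _ => many

theorem sat_add : ∀ a b, sat (a + b) = add (sat a) (sat b)
  | 0, b => by simp [sat, add]
  | 1, 0 => rfl
  | 1, 1 => rfl
  | 1, b + 2 => by
    rw [show 1 + (b + 2) = (b + 1) + 2 by omega]
    rfl
  | a + 2, 0 => rfl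
  | a + 2, 1 => rfl
  | a + 2, b + 2 => rfl

theorem zero_add (a : Cell) : add zero a = a := rfl

theorem add_assoc (a b c : Cell) : add (add a b) c = add a (add b c) := by
  cases a <;> cases b <;> cases c <;> rfl

theorem sat_eq_zero : ∀ {n}, sat n = zero ↔ n = 0
  | 0 => by simp [sat]
  | 1 => by simp [sat]
  | n + 2 => by simp [sat]

theorem sat_eq_one : ∀ {n}, sat n = one ↔ n = 1
  | 0 => by simp [sat]
  | 1 => by simp [sat]
  | n + 2 => by simp [sat]

theorem sat_eq_many : ∀ {n}, sat n = many ↔ 2 ≤ n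
  | 0 => by simp [sat]
  | 1 => by simp [sat]
  | n + 2 => by simp [sat]

end Cell

/-- A row of the intersection matrix: the sizes of the intersections of a conjunction with the
clauses, and whether the conjunction has a variable outside of all clauses. -/
abbrev Row := List Cell × Bool

namespace Row

/-- The column sums of a list of rows, added to `s`. -/
def colSums (s : List Cell) (R : List Row) : List Cell :=
  R.foldl (fun s r => List.zipWith Cell.add s r.1) s

/-- The sum of `a` and the entries of a row in the columns with the sum `many`. -/
def restSum : Cell → List Cell → List Cell → Cell
  | a, s :: ss, e :: es => restSum (if s = .many then a.add e else a) ss es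
  | a, _, _ => a

/-- The variable of the row that lies in a column with the sum `many` is forced to be false. -/
def fires (s : List Cell) (r : Row) : Bool :=
  !r.2 && restSum .zero s r.1 = .one

/-- Removal of the forced variable. -/
def update (s : List Cell) (r : Row) : Row :=
  -- When the row fires, its entries in the `many` columns sum to one, so only the forced variable
  -- is erased. That variable then lies outside all clauses, hence the second component.
  (List.zipWith (fun a e => if fires s r ∧ a = .many then .zero else e) s r.1, r.2 || fires s r)

/-- One round of unit propagation. -/
def propagate (z : List Cell) (R : List Row) : List Row :=
  R.map (update (colSums z R))

/-- A clause is empty, or a conjunction consists of variables of one-element clauses. -/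
def conflict (z : List Cell) (R : List Row) : Bool :=
  (colSums z R).any (· = .zero) ||
    R.any fun r => !r.2 && restSum .zero (colSums z R) r.1 = .zero

/-- A given number of rounds, with a record of the conflicts. -/
def rounds (z : List Cell) : ℕ → List Row → Bool → List Row × Bool
  | 0, R, b => (R, b)
  | n + 1, R, b => rounds z n (propagate z R) (b || conflict z R)

/-- Some row has both zero and non-zero entries. -/
def mixed (R : List Row) : Bool :=
  R.any fun r => r.1.any (· = .zero) && r.1.any (· ≠ .zero)

theorem rounds_of_round_eq {z : List Cell} {R : List Row} (h : propagate z R = R) :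
    ∀ (n : ℕ) (b : Bool), rounds z (n + 1) R b = (R, b || conflict z R)
  | 0, b => by simp [rounds, h]
  | n + 1, b => by
    rw [rounds, h, rounds_of_round_eq h n]
    simp

end Row

/-- The row of the conjunction `d`. -/
def rowOf (C : Groups) (d : List ℕ) : Row :=
  (C.map fun c => Cell.sat (d.countP (· ∈ c)), d.any fun x => decide (∀ c ∈ C, x ∉ c))

/-- The intersection matrix of the conjunctions of `D` with the clauses of `C`. -/
def matrix (C D : Groups) : List Row :=
  D.map (rowOf C)

/-! ### Correctness of propagation: matrix rounds mirror the deletion of forced variables -/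

section Matrix

open Row

variable {C D : Groups}

theorem colSums_matrix_aux (C₀ : Groups) : ∀ (D : Groups) (n : List ℕ → ℕ),
    colSums (C.map fun c => Cell.sat (n c)) (D.map fun d => (C.map fun c =>
      Cell.sat (d.countP (· ∈ c)), (rowOf C₀ d).2)) =
      C.map fun c => Cell.sat (n c + D.flatten.countP (· ∈ c))
  | [], n => by simp [colSums]
  | d :: D, n => by
    have := colSums_matrix_aux C₀ D fun c => n c + d.countP (· ∈ c)
    rw [colSums] at this ⊢
    simp only [List.map_cons, List.foldl_cons, List.zipWith_map, List.zipWith_self,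
      ← Cell.sat_add, this, List.flatten_cons, List.countP_append, Nat.add_assoc]

/-- Every variable of a clause lies in exactly one conjunction, so the intersections of the clause
with all conjunctions partition it. Clause sizes can thus be read off the matrix. -/
theorem colSums_matrix (hC : C.IsReadOnce) (hD : D.IsReadOnce)
    (hCD : ∀ c ∈ C, ∀ x ∈ c, ∃ d ∈ D, x ∈ d) :
    colSums (List.replicate C.length .zero) (matrix C D) = C.map fun c => Cell.sat c.length := by
  have h := colSums_matrix_aux (C := C) C D fun _ => 0
  rw [show (C.map fun _ => Cell.sat 0) = List.replicate C.length .zero from List.map_const' ..]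
    at h
  refine h.trans (List.map_congr_left fun c hc => ?_)
  rw [Nat.zero_add, List.countP_eq_length_filter]
  refine congrArg _ (List.Perm.length_eq ?_)
  refine (List.perm_ext_iff_of_nodup ((Groups.isReadOnce_iff_nodup.1 hD).filter _)
    (hC.nodup hc)).2 fun x => ?_
  simp only [List.mem_filter, decide_eq_true_eq, and_iff_right_iff_imp, List.mem_flatten]
  exact hCD c hc x

theorem countP_or {p q r : ℕ → Prop} [DecidablePred p] [DecidablePred q] [DecidablePred r]
    {l : List ℕ} (hr : ∀ x ∈ l, r x ↔ p x ∨ q x) (hpq : ∀ x ∈ l, p x → ¬ q x) :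
    l.countP (r ·) = l.countP (p ·) + l.countP (q ·) := by
  induction l with
  | nil => rfl
  | cons x l ih =>
    simp only [List.forall_mem_cons] at hr hpq
    simp only [List.countP_cons, ih hr.2 hpq.2, hr.1, decide_eq_true_eq]
    by_cases hp : p x
    · simp [hp, hpq.1 hp]
      omega
    · simp [hp]
      omega

-- The columns with sum `many` are the clauses of big variables, and a variable lies in at most one
-- clause, so nothing is counted twice.
open Classical in
theorem restSum_rowOf (d : List ℕ) : ∀ {C : Groups} (_ : C.IsReadOnce) (a : Cell),
    restSum a (C.map fun c => Cell.sat c.length) (rowOf C d).1 =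
      a.add (Cell.sat (d.countP (Big C ·)))
  | [], _, a => by
    have : d.countP (Big [] ·) = 0 := by simp [Big]
    rw [this]
    cases a <;> rfl
  | c :: C, h, a => by
    have hC : Groups.IsReadOnce C := fun x =>
      le_trans (by simp) (h x)
    have ih := restSum_rowOf d hC
    simp only [rowOf] at ih
    simp only [rowOf, List.map_cons, restSum, ih, Cell.sat_eq_many]
    split_ifs with hl
    · rw [Cell.add_assoc, ← Cell.sat_add]
      congr 2
      refine (countP_or (p := (· ∈ c)) (q := Big C) (r := Big (c :: C)) ?_ ?_).symm
      · intro x _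
        simp [Big, hl]
      · rintro x - hx ⟨c', hc', hx', -⟩
        have := (List.nodup_append.1 (Groups.isReadOnce_iff_nodup.1 h)).2.2 x hx x
          (List.mem_flatten.2 ⟨c', hc', hx'⟩)
        exact this rfl
    · congr 2
      refine List.countP_congr fun x _ => ?_
      rw [decide_eq_true_eq, decide_eq_true_eq]
      simp [Big, hl]

open Classical in
/-- The conjunction `d` forces a variable to be false. -/
def Fires (C : Groups) (d : List ℕ) : Prop :=
  (∀ x ∈ d, ∃ c ∈ C, x ∈ c) ∧ d.countP (Big C ·) = 1

theorem rowOf_snd_eq_false {d : List ℕ} :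
    (rowOf C d).2 = false ↔ ∀ x ∈ d, ∃ c ∈ C, x ∈ c := by
  simp [rowOf]

theorem fires_rowOf (hC : C.IsReadOnce) {d : List ℕ} :
    fires (C.map fun c => Cell.sat c.length) (rowOf C d) = true ↔ Fires C d := by
  rw [fires, restSum_rowOf d hC, Cell.zero_add, Bool.and_eq_true, Bool.not_eq_true',
    rowOf_snd_eq_false, decide_eq_true_eq, Cell.sat_eq_one, Fires]

/-- The variable `x` is forced to be false. -/
def Forced (C D : Groups) (x : ℕ) : Prop :=
  Big C x ∧ ∃ d ∈ D, x ∈ d ∧ Fires C d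

open Classical in
/-- Removal of the variables that are forced to be false. -/
noncomputable def removeForced (C D : Groups) : Groups :=
  C.map fun c => c.filter fun x => ¬ Forced C D x

-- As `D` is read-once, a variable of `d` can only be forced by `d` itself; so row `d` changes only
-- if `d` fires, and then loses exactly its big variables.
open Classical in
theorem rowOf_removeForced (hC : C.IsReadOnce) (hD : D.IsReadOnce) {d : List ℕ} (hd : d ∈ D) :
    rowOf (removeForced C D) d = Row.update (C.map fun c => Cell.sat c.length) (rowOf C d) := by
  have hforced {x} (hx : x ∈ d) : Forced C D x ↔ Big C x ∧ Fires C d := by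
    refine and_congr_right fun _ => ⟨?_, fun h => ⟨d, hd, hx, h⟩⟩
    rintro ⟨d', hd', hx', h⟩
    rwa [hD.group_unique hd hd' hx hx']
  refine Prod.ext ?_ ?_
  · simp only [rowOf, removeForced, Row.update, List.map_map, List.zipWith_map,
      List.zipWith_self]
    refine List.map_congr_left fun c hc => ?_
    simp only [Function.comp_apply]
    have hbig {x} (hx : x ∈ c) : Big C x ↔ 2 ≤ c.length := by
      refine ⟨?_, fun h => ⟨c, hc, hx, h⟩⟩
      rintro ⟨c', hc', hx', h⟩
      rwa [hC.group_unique hc hc' hx hx']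
    have hf := fires_rowOf hC (d := d)
    simp only [rowOf] at hf
    simp only [hf, Cell.sat_eq_many]
    split_ifs with h
    · rw [Cell.sat_eq_zero, List.countP_eq_zero]
      intro x hx
      simp only [List.mem_filter, decide_eq_true_eq, not_and, not_not]
      exact fun hxc => (hforced hx).2 ⟨(hbig hxc).2 h.2, h.1⟩
    · refine congrArg _ (List.countP_congr fun x hx => ?_)
      simp only [List.mem_filter, decide_eq_true_eq, and_iff_left_iff_imp]
      exact fun hxc hx' => h ⟨((hforced hx).1 hx').2, (hbig hxc).1 ((hforced hx).1 hx').1⟩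
  · change _ = ((rowOf C d).2 || _)
    rw [Bool.eq_iff_iff, Bool.or_eq_true]
    simp only [fires_rowOf hC]
    simp only [rowOf, List.any_eq_true, decide_eq_true_eq, removeForced, List.forall_mem_map,
      List.mem_filter, not_and, not_not]
    constructor
    · rintro ⟨x, hx, h⟩
      by_cases hxC : ∃ c ∈ C, x ∈ c
      · obtain ⟨c, hc, hxc⟩ := hxC
        exact .inr ((hforced hx).1 (h c hc hxc)).2
      · push Not at hxC
        exact .inl ⟨x, hx, hxC⟩
    · rintro (⟨x, hx, h⟩ | h)
      · exact ⟨x, hx, fun c hc hxc => absurd hxc (h c hc)⟩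
      · have : 0 < d.countP (Big C ·) := by
          rw [h.2]
          exact Nat.one_pos
        obtain ⟨x, hx, hb⟩ := List.countP_pos_iff.1 this
        exact ⟨x, hx, fun c hc hxc => (hforced hx).2 ⟨by simpa using hb, h⟩⟩

/-- `C ∨ D` computes `f`, and the variables occur as required. -/
structure Represents (C D : Groups) (f : (ℕ → Bool) → Bool) : Prop where
  ne_nil : C ≠ []
  readOnce : C.IsReadOnce
  subset : ∀ c ∈ C, ∀ x ∈ c, ∃ d ∈ D, x ∈ d
  eval : ∀ v, (C.evalCNF v || D.evalDNF v) = f v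

variable {f : (ℕ → Bool) → Bool}

theorem Represents.propagate_matrix (h : Represents C D f) (hD : D.IsReadOnce) :
    propagate (List.replicate C.length .zero) (matrix C D) = matrix (removeForced C D) D := by
  rw [propagate, colSums_matrix h.readOnce hD h.subset, matrix, List.map_map, matrix]
  exact List.map_congr_left fun d hd => (rowOf_removeForced h.readOnce hD hd).symm

open Classical in
theorem length_removeForced : (removeForced C D).length = C.length := by
  simp [removeForced]

-- All forced variables can go at once. Let `C` hold at `v` while the reduced CNF and `D` fail. Then
-- some forced `x` is true, and its firing conjunction contains a false `y`. The clause of `y`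
-- holds, so it has another variable and `y` is big. Since only one variable of that conjunction is
-- big, `y = x`, a contradiction.
open Classical in
theorem Represents.removeForced (h : Represents C D f) :
    Represents (removeForced C D) D f where
  ne_nil := by simpa [ReadOnce.removeForced] using h.ne_nil
  readOnce x := by
    refine le_trans ?_ (h.readOnce x)
    rw [ReadOnce.removeForced, List.count_flatten, List.count_flatten, List.map_map]
    exact List.sum_le_sum fun c _ => List.filter_sublist.count_le x
  subset := by
    simp only [ReadOnce.removeForced, List.forall_mem_map, List.mem_filter]
    exact fun c hc x hx => h.subset c hc x hx.1
  eval v := by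
    rw [← h.eval, Bool.eq_iff_iff, Bool.or_eq_true, Bool.or_eq_true, Groups.evalCNF_eq_true,
      Groups.evalCNF_eq_true, Groups.evalDNF_eq_true, ReadOnce.removeForced]
    simp only [List.forall_mem_map, List.mem_filter, decide_eq_true_eq]
    refine ⟨Or.imp_left fun hv c hc => ?_, ?_⟩
    · obtain ⟨x, hx, hxv⟩ := hv c hc
      exact ⟨x, hx.1, hxv⟩
    rintro (hv | hv)
    swap
    · exact .inr hv
    by_contra hcon
    push Not at hcon
    obtain ⟨⟨c, hc, hcv⟩, hdv⟩ := hcon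
    obtain ⟨x, hx, hxv⟩ := hv c hc
    obtain ⟨hbig, d, hd, hxd, hdC, hcount⟩ : Forced C D x := by
      by_contra hx'
      exact hcv x ⟨hx, hx'⟩ hxv
    obtain ⟨y, hy, hyv⟩ := hdv d hd
    obtain ⟨c', hc', hyc'⟩ := hdC y hy
    have hyx : y ≠ x := by
      rintro rfl
      exact hyv hxv
    obtain ⟨z, hz, hzv⟩ := hv c' hc'
    have hl : ¬ c'.length < 2 := fun hl => hyv (eq_of_length_lt_two hl hz hyc' ▸ hzv)
    have hybig : Big C y := ⟨c', hc', hyc', not_lt.1 hl⟩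
    rw [List.countP_eq_length_filter] at hcount
    exact hyx (eq_of_length_lt_two (l := d.filter (Big C ·)) (by omega) (by simp [hy, hybig])
      (by simp [hxd, hbig]))

theorem Represents.conflict_matrix (h : Represents C D f) (hD : D.IsReadOnce) :
    conflict (List.replicate C.length .zero) (matrix C D) = true ↔
      (∃ c ∈ C, c = []) ∨ ∃ d ∈ D, (∀ x ∈ d, ∃ c ∈ C, x ∈ c) ∧ ∀ x ∈ d, ¬ Big C x := by
  classical
  rw [conflict, colSums_matrix h.readOnce hD h.subset, Bool.or_eq_true]
  refine or_congr ?_ ?_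
  · simp [Cell.sat_eq_zero]
  · rw [matrix, List.any_map, List.any_eq_true]
    refine exists_congr fun d => and_congr_right fun hd => ?_
    rw [Function.comp_apply, restSum_rowOf d h.readOnce, Cell.zero_add, Bool.and_eq_true,
      Bool.not_eq_true', rowOf_snd_eq_false, decide_eq_true_eq, Cell.sat_eq_zero,
      List.countP_eq_zero]
    simp

/-- In a conflict `C` implies `D`: an empty clause makes `C` unsatisfiable, and one-variable clauses
force all variables of the conflicting conjunction. -/
theorem Represents.eval_of_conflict (h : Represents C D f) (hD : D.IsReadOnce)
    (hc : conflict (List.replicate C.length .zero) (matrix C D) = true) (v : ℕ → Bool) :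
    D.evalDNF v = f v := by
  rw [← h.eval, Bool.eq_iff_iff, Bool.or_eq_true, Groups.evalCNF_eq_true]
  refine ⟨.inr, ?_⟩
  rintro (hv | hv)
  swap
  · exact hv
  rcases (h.conflict_matrix hD).1 hc with ⟨c, hc, rfl⟩ | ⟨d, hd, hdC, hdb⟩
  · obtain ⟨x, hx, -⟩ := hv [] hc
    cases hx
  · refine Groups.evalDNF_eq_true.2 ⟨d, hd, fun x hx => ?_⟩
    obtain ⟨c, hc, hxc⟩ := hdC x hx
    obtain ⟨y, hy, hyv⟩ := hv c hc
    have hl : c.length < 2 := not_le.1 fun hl => hdb x hx ⟨c, hc, hxc, hl⟩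
    exact eq_of_length_lt_two hl hy hxc ▸ hyv

theorem mixed_matrix : mixed (matrix C D) = false ↔
    ∀ d ∈ D, (∀ c ∈ C, ∃ x ∈ c, x ∈ d) ∨ ∀ c ∈ C, ∀ x ∈ c, x ∉ d := by
  rw [mixed, List.any_eq_false, matrix, List.forall_mem_map]
  refine forall₂_congr fun d hd => ?_
  simp only [rowOf, Bool.and_eq_true, List.any_map, List.any_eq_true, Function.comp_apply,
    decide_eq_true_eq, Cell.sat_eq_zero, ne_eq, List.countP_eq_zero, not_and_or]
  push Not
  refine or_congr (forall₂_congr fun c hc => ?_) (forall₂_congr fun c hc => ?_)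
  · exact exists_congr fun x => and_comm
  · exact ⟨fun h x hx hxd => h x hxd hx, fun h x hx hxd => h x hxd hx⟩

/-- Induction on the rounds, with the number of rows whose conjunction lies inside `C` as the
measure. A conflict-free round either lowers it, because some row fires, or leaves the matrix fixed
for all later rounds. -/
theorem exists_of_rounds (hD : D.IsReadOnce) : ∀ (n : ℕ) {C : Groups} (_ : Represents C D f)
    (_ : (matrix C D).countP (!·.2) < n),
    (∀ v, D.evalDNF v = f v) ∧
      (rounds (List.replicate C.length .zero) n (matrix C D) false).2 = true ∨
    ∃ C', Represents C' D f ∧ (∀ d ∈ D, ¬ Fires C' d) ∧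
      conflict (List.replicate C'.length .zero) (matrix C' D) = false ∧
      rounds (List.replicate C.length .zero) n (matrix C D) false = (matrix C' D, false)
  | 0, C, _, hn => absurd hn (Nat.not_lt_zero _)
  | n + 1, C, h, hn => by
    cases hcon : conflict (List.replicate C.length .zero) (matrix C D) with
    | true =>
      refine .inl ⟨h.eval_of_conflict hD hcon, ?_⟩
      -- A recorded conflict is never erased, so later matrices no longer matter.
      have htrue : ∀ (n : ℕ) R, (rounds (List.replicate C.length .zero) n R true).2 = true := by
        intro n
        induction n with
        | zero => exact fun R => rfl
        | succ n ih => exact fun R => ih _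
      rw [rounds, hcon]
      exact htrue _ _
    | false =>
      by_cases hf : ∃ d ∈ D, Fires C d
      · obtain ⟨d, hd, hfd⟩ := hf
        -- The bits of the rows are only ever switched on, and that of the firing row `d` is.
        have hlt : (matrix (removeForced C D) D).countP (!·.2) < (matrix C D).countP (!·.2) := by
          rw [← h.propagate_matrix hD, propagate, List.countP_map]
          have hle : ∀ r : Row, (!(Row.update (C.map fun c => Cell.sat c.length) r).2) = true →
              (!r.2) = true := by
            intro r
            simp only [Row.update, Bool.not_eq_true', Bool.or_eq_false_iff]
            exact And.left
          rw [colSums_matrix h.readOnce hD h.subset]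
          refine lt_of_le_of_ne (List.countP_mono_left fun r _ => hle r) fun heq => ?_
          rw [List.countP_eq_length_filter, List.countP_eq_length_filter] at heq
          have hsub : ((matrix C D).filter ((!·.2) ∘ Row.update (C.map fun c => Cell.sat c.length))).Sublist
              ((matrix C D).filter (!·.2)) :=
            List.monotone_filter_right _ hle
          have heq' := hsub.eq_of_length heq
          have hmem : rowOf C d ∈ (matrix C D).filter (!·.2) := by
            rw [List.mem_filter]
            exact ⟨List.mem_map_of_mem hd, by rw [rowOf_snd_eq_false.2 hfd.1]; rfl⟩
          rw [← heq', List.mem_filter] at hmem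
          have := hmem.2
          simp only [Function.comp_apply, Row.update, (fires_rowOf h.readOnce).2 hfd] at this
          simp at this
        have ih := exists_of_rounds hD n h.removeForced (by omega)
        rw [rounds, hcon, h.propagate_matrix hD]
        rw [length_removeForced] at ih
        exact ih
      · push Not at hf
        refine .inr ⟨C, h, hf, hcon, ?_⟩
        rw [rounds_of_round_eq, hcon]
        · rfl
        · rw [h.propagate_matrix hD]
          have hF : ∀ x, ¬ Forced C D x := fun x ⟨_, d, hd, _, h⟩ => hf d hd h
          have : removeForced C D = C := by
            simp [removeForced, hF]
          rw [this]

/-- The outcome of unit propagation decides whether `C ∨ D` is read-once. -/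
theorem Expression.Admissible.isReadOnceFunction_iff {E : Expression} (hE : E.Admissible) {n : ℕ}
    (hn : E.dnf.length < n) {R : List Row} {b : Bool}
    (hR : Row.rounds (List.replicate E.cnf.length .zero) n (matrix E.cnf E.dnf) false = (R, b)) :
    IsReadOnceFunction E.eval ↔ (b || !Row.mixed R) = true := by
  classical
  have h0 : Represents E.cnf E.dnf E.eval :=
    ⟨hE.cnf_isFormula.1, hE.cnf_readOnce, fun c hc x hx => hE.occurs x ⟨c, hc, hx⟩, fun _ => rfl⟩
  have hlt : (matrix E.cnf E.dnf).countP (!·.2) < n :=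
    lt_of_le_of_lt (List.countP_le_length.trans_eq (List.length_map _)) hn
  rcases exists_of_rounds hE.dnf_readOnce n h0 hlt with ⟨hD, hb⟩ | ⟨C, hC, hf, hcon, hr⟩
  · rw [hR] at hb
    simp only at hb
    simp only [hb, Bool.true_or, iff_true]
    rw [← funext hD]
    exact hE.dnf_isFormula.isReadOnceFunction_evalDNF hE.dnf_readOnce
  · rw [hR, Prod.mk.injEq] at hr
    obtain ⟨rfl, rfl⟩ := hr
    have hcon' := mt (hC.conflict_matrix hE.dnf_readOnce).2 (by simp [hcon])
    push Not at hcon'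
    rw [← funext hC.eval, Bool.false_or, Bool.not_eq_true', mixed_matrix]
    constructor
    · refine all_or_none_of_isReadOnceFunction hcon'.1 hC.readOnce hE.dnf_isFormula.2
        hE.dnf_readOnce hC.subset fun d hd => ?_
      -- For `d` inside `C`, the number of big variables is not zero, as there is no conflict, and
      -- not one, as nothing fires.
      by_cases hdC : ∀ x ∈ d, ∃ c ∈ C, x ∈ c
      · obtain ⟨x, hx, hxb⟩ := hcon'.2 d hd hdC
        have h1 : d.countP (Big C ·) ≠ 1 := fun h => hf d hd ⟨hdC, h⟩
        have h2 : 0 < d.countP (Big C ·) := List.countP_pos_iff.2 ⟨x, hx, by simpa using hxb⟩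
        rw [← List.countP_eq_length_filter]
        exact .inr (by omega)
      · push Not at hdC
        exact .inl hdC
    · exact isReadOnceFunction_of_all_or_none ⟨hC.ne_nil, hcon'.1⟩ hC.readOnce hE.dnf_isFormula
        hE.dnf_readOnce

end Matrix

end ReadOnce

namespace ReadOnce

/-! ### Stacks, registers and rules for runs -/

namespace Cmd

variable {K : Type} {Γ : K → Type} {ρ : Type} [DecidableEq K]

theorem Exec.loop_push {k k' : K} (hk : k ≠ k') (g : Γ k → Γ k') (r : ρ) :
    ∀ (l : List (Γ k)) (S : ∀ k, List (Γ k)), S k = l →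
      Exec (loop k fun a => Cmd.push k' (g a)) (r, S)
        (r, Function.update (Function.update S k []) k' ((l.map g).reverse ++ S k')) (2 * l.length + 1)
  | [], S, h => by
    have h1 : Function.update S k [] = S := by rw [← h, Function.update_eq_self]
    have h2 : Function.update S k' ((([] : List (Γ k)).map g).reverse ++ S k') = S :=
      Function.update_eq_self k' S
    rw [h1, h2]
    exact .loop_nil h
  | a :: l, S, h => by
    have ih := Exec.loop_push hk g r l (Function.update (Function.update S k l) k' (g a :: S k'))
      (by simp [hk])
    have h2 : Function.update (Function.update (Function.update (Function.update S k l) k'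
        (g a :: S k')) k []) k' ((l.map g).reverse ++
          Function.update (Function.update S k l) k' (g a :: S k') k') =
        Function.update (Function.update S k []) k' (((a :: l).map g).reverse ++ S k') := by
      funext j
      by_cases hj : j = k'
      · subst hj
        simp
      · by_cases hj' : j = k
        · subst hj'
          simp [hj]
        · simp [hj, hj']
    rw [h2] at ih
    refine (Exec.loop_cons h (t := 1) ?_ ih).mono (by simp only [List.length_cons]; omega)
    have := Exec.push (k := k') (a := g a) (r := r) (S := Function.update S k l)
    rwa [Function.update_of_ne hk.symm] at this

theorem Exec.loop_skip {k : K} (r : ρ) :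
    ∀ (l : List (Γ k)) (S : ∀ k, List (Γ k)), S k = l →
      Exec (loop k fun _ => Cmd.skip) (r, S) (r, Function.update S k []) (2 * l.length + 1)
  | [], S, h => by
    have h1 : Function.update S k [] = S := by rw [← h, Function.update_eq_self]
    rw [h1]
    exact .loop_nil h
  | a :: l, S, h => by
    have ih := Exec.loop_skip r l (Function.update S k l) (by simp)
    rw [Function.update_idem] at ih
    exact (Exec.loop_cons h .skip ih).mono (by simp only [List.length_cons]; omega)

end Cmd

/-- The stacks of the machine. -/
inductive Stack where
  | inp | cnf | cnf' | x | x' | y | col | col' | buf | buf' | mat | mat' | cnt | out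
  deriving DecidableEq

namespace Stack

instance : Fintype Stack :=
  ⟨{inp, cnf, cnf', x, x', y, col, col', buf, buf', mat, mat', cnt, out},
    fun k => by cases k <;> simp⟩

/-- The alphabets of the stacks. -/
abbrev Alphabet : Stack → Type
  | inp | cnf | cnf' => Symb
  | x | x' | y => Bool
  | col | col' | buf | buf' => Cell
  | mat | mat' => Cell ⊕ Bool
  | cnt => Unit
  | out => Bool

instance : ∀ k, Finite (Alphabet k)
  | inp | cnf | cnf' => inferInstanceAs (Finite Symb)
  | x | x' | y => inferInstanceAs (Finite Bool)
  | col | col' | buf | buf' => inferInstanceAs (Finite Cell)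
  | mat | mat' => inferInstanceAs (Finite (Cell ⊕ Bool))
  | cnt => inferInstanceAs (Finite Unit)
  | out => inferInstanceAs (Finite Bool)

end Stack

/-- The register of the machine. -/
structure Reg where
  /-- the separator of the two parts of the input has been read -/
  afterOr : Bool := false
  /-- the two variables that are being compared agree -/
  same : Bool := true
  /-- the current variable occurs in the current clause -/
  hit : Bool := false
  /-- the current variable occurs in some clause -/
  found : Bool := false
  /-- the current conjunction has a variable outside of all clauses -/
  outside : Bool := false
  /-- a conflict has occurred -/
  conflict : Bool := false
  /-- the current row has a zero entry -/
  hasZero : Bool := false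
  /-- the current row has a non-zero entry -/
  hasNonzero : Bool := false
  /-- some row has both -/
  mixed : Bool := false
  /-- the sum of entries of the current row -/
  acc : Cell := .zero

instance : Finite Reg := by
  refine Finite.of_injective (β := Bool × Bool × Bool × Bool × Bool × Bool × Bool × Bool × Bool × Cell)
    (fun r => (r.afterOr, r.same, r.hit, r.found, r.outside, r.conflict, r.hasZero, r.hasNonzero,
      r.mixed, r.acc)) ?_
  rintro ⟨⟩ ⟨⟩ h
  simpa using h

/-- The contents of the stacks. -/
structure Store where
  inp : List Symb := []
  cnf : List Symb := []
  cnf' : List Symb := []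
  x : List Bool := []
  x' : List Bool := []
  y : List Bool := []
  col : List Cell := []
  col' : List Cell := []
  buf : List Cell := []
  buf' : List Cell := []
  mat : List (Cell ⊕ Bool) := []
  mat' : List (Cell ⊕ Bool) := []
  cnt : List Unit := []
  out : List Bool := []

namespace Store

/-- The content of a stack. -/
@[simp]
def get (S : Store) : (k : Stack) → List k.Alphabet
  | .inp => S.inp
  | .cnf => S.cnf
  | .cnf' => S.cnf'
  | .x => S.x
  | .x' => S.x'
  | .y => S.y
  | .col => S.col
  | .col' => S.col'
  | .buf => S.buf
  | .buf' => S.buf'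
  | .mat => S.mat
  | .mat' => S.mat'
  | .cnt => S.cnt
  | .out => S.out

/-- Replacement of the content of a stack. -/
@[simp]
def set (S : Store) : (k : Stack) → List k.Alphabet → Store
  | .inp, l => { S with inp := l }
  | .cnf, l => { S with cnf := l }
  | .cnf', l => { S with cnf' := l }
  | .x, l => { S with x := l }
  | .x', l => { S with x' := l }
  | .y, l => { S with y := l }
  | .col, l => { S with col := l }
  | .col', l => { S with col' := l }
  | .buf, l => { S with buf := l }
  | .buf', l => { S with buf' := l }
  | .mat, l => { S with mat := l }
  | .mat', l => { S with mat' := l }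
  | .cnt, l => { S with cnt := l }
  | .out, l => { S with out := l }

/-- Bridge from records to functions: with named fields, the states of a run can be compared by
`simp` or `rfl` instead of by rewriting nested `Function.update`s. -/
theorem get_set (S : Store) (k : Stack) (l : List k.Alphabet) :
    (S.set k l).get = Function.update S.get k l := by
  funext k'
  cases k <;> cases k' <;> first | exact (Function.update_self ..).symm | rfl

end Store

/-- The programs of the machine. -/
abbrev Prog := Cmd Stack Stack.Alphabet Reg

/-- The program `c` leads from `r`, `S` to `r'`, `S'` in at most `t` steps. -/
def Run (c : Prog) (r : Reg) (S : Store) (r' : Reg) (S' : Store) (t : ℕ) : Prop :=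
  Cmd.Exec c (r, S.get) (r', S'.get) t

/-- The passes of `loop k b` over the symbols `p` lead from `r`, `S` to `r'`, `S'`, and each of them
takes at most `T` steps. -/
def Pass (k : Stack) (b : k.Alphabet → Prog) (T : ℕ) (p : List k.Alphabet) (r : Reg) (S : Store)
    (r' : Reg) (S' : Store) : Prop :=
  Cmd.Iter k b T p (r, S.get) (r', S'.get)

section Rules

variable {r r' r'' : Reg} {S S' S'' : Store} {t t' T T' : ℕ} {c d : Prog} {k k' : Stack}

theorem Run.mono (h : Run c r S r' S' t) (ht : t ≤ t') : Run c r S r' S' t' :=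
  Cmd.Exec.mono h ht

theorem Run.congr (h : Run c r S r' S' t) (hr : r' = r'') (hS : S' = S'') (ht : t ≤ t') :
    Run c r S r'' S'' t' :=
  hr ▸ hS ▸ h.mono ht

theorem Run.skip : Run .skip r S r S 1 :=
  Cmd.Exec.skip

theorem Run.set {f : Reg → Reg} : Run (.set f) r S (f r) S 1 :=
  Cmd.Exec.set

theorem Run.push {a : k.Alphabet} : Run (.push k a) r S r (S.set k (a :: S.get k)) 1 := by
  rw [Run, Store.get_set]
  exact .push

theorem Run.pop_cons {f : Option k.Alphabet → Prog} {a : k.Alphabet} {l : List k.Alphabet}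
    (h : S.get k = a :: l) (h' : Run (f (some a)) r (S.set k l) r' S' t) :
    Run (.pop k f) r S r' S' (t + 1) := by
  rw [Run, Store.get_set] at h'
  refine .pop ?_
  rwa [h]

theorem Run.pop_nil {f : Option k.Alphabet → Prog} (h : S.get k = [])
    (h' : Run (f none) r S r' S' t) : Run (.pop k f) r S r' S' (t + 1) := by
  refine .pop ?_
  rw [h, List.head?_nil, List.tail_nil, ← h, Function.update_eq_self]
  exact h'

theorem Run.read {f : Reg → Prog} (h : Run (f r) r S r' S' t) :
    Run (.read f) r S r' S' (t + 1) :=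
  Cmd.Exec.read h

theorem Run.seq (h : Run c r S r' S' t) (h' : Run d r' S' r'' S'' t') :
    Run (.seq c d) r S r'' S'' (t + t') :=
  Cmd.Exec.seq h h'

/-- Moving a stack reverses it. Data that is read is collected on a partner stack and moved back,
which restores the order. -/
theorem Run.move (hk : k ≠ k') (g : k.Alphabet → k'.Alphabet) :
    Run (.loop k fun a => Cmd.push k' (g a)) r S r
      ((S.set k []).set k' (((S.get k).map g).reverse ++ S.get k')) (2 * (S.get k).length + 1) := by
  rw [Run, Store.get_set, Store.get_set]
  exact Cmd.Exec.loop_push hk g r _ _ rfl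

theorem Run.clear : Run (.loop k fun _ => Cmd.skip) r S r (S.set k []) (2 * (S.get k).length + 1) := by
  rw [Run, Store.get_set]
  exact Cmd.Exec.loop_skip r _ _ rfl

variable {b : k.Alphabet → Prog} {p q : List k.Alphabet}

theorem Pass.nil : Pass k b T [] r S r S :=
  Cmd.Iter.nil

theorem Pass.cons {a : k.Alphabet} {l : List k.Alphabet} (h : S.get k = a :: l)
    (h' : Run (b a) r (S.set k l) r' S' T) (h'' : Pass k b T p r' S' r'' S'') :
    Pass k b T (a :: p) r S r'' S'' := by
  rw [Run, Store.get_set] at h'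
  exact Cmd.Iter.cons h h' h''

theorem Pass.single {a : k.Alphabet} {l : List k.Alphabet} (h : S.get k = a :: l)
    (h' : Run (b a) r (S.set k l) r' S' T) : Pass k b T [a] r S r' S' :=
  .cons h h' .nil

theorem Pass.append (h : Pass k b T p r S r' S') (h' : Pass k b T q r' S' r'' S'') :
    Pass k b T (p ++ q) r S r'' S'' :=
  Cmd.Iter.append h h'

theorem Pass.run (h : Pass k b T p r S r' S') (hS : S'.get k = []) :
    Run (.loop k b) r S r' S' (p.length * (T + 1) + 1) :=
  Cmd.Iter.exec h hS

end Rules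

/-! ### The program -/

namespace Machine

open Stack

/-- Compares a symbol of the stack `y` with the top of the stack `x`. -/
def compareBit (b : Bool) : Prog :=
  .pop x fun
    | none => .set fun r => { r with same := false }
    | some b' => .seq (.push x' b') (.set fun r => { r with same := r.same && b' == b })

/-- Compares the words on the stacks `x` and `y` and deletes the latter. -/
def compare : Prog :=
  .seq (.loop y compareBit)
    (.seq
      -- A symbol left on `x` means that its word is the longer one; it is put back before the
      -- compared part is restored from `x'`.
      (.pop x fun
        | none => .skip
        | some b => .seq (.push x b) (.set fun r => { r with same := false }))
      (.loop x' fun b => .push x b))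

/-- Processes a symbol of the CNF, with a variable on the stack `x`. -/
def scanSymb : Symb → Prog
  | .bit b => .seq (.push cnf' (.bit b)) (.push y b)
  | .endVar => .seq (.push cnf' .endVar) (.seq compare
      (.set fun r => { r with same := true, hit := r.hit || r.same, found := r.found || r.same }))
  | .endGroup => .seq (.push cnf' .endGroup) (.pop col fun
      | none => .skip
      | some e => .read fun r => .seq (.push col' (if r.hit then e.add .one else e))
          (.set fun r => { r with hit := false }))
  | .or => .skip

/-- Transfers an entry of the current row to the matrix. -/
def emitCell (e : Cell) : Prog :=
  .seq (.push mat' (.inl e)) (.push col' .zero)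

/-- Processes a symbol of the DNF. -/
def dnfSymb : Symb → Prog
  | .bit b => .push x b
  | .endVar => .seq (.loop cnf scanSymb) (.seq (.loop cnf' fun s => .push cnf s)
      (.seq (.loop col' fun e => .push col e) (.seq (.loop x fun _ => .skip)
        (.set fun r => { r with found := false, outside := r.outside || !r.found }))))
  | .endGroup => .seq (.loop col emitCell)
      (.seq (.loop col' fun e => .push col e)
        (.read fun r => .seq (.push mat' (.inr r.outside)) (.seq (.push cnt ())
          (.set fun r => { r with outside := false }))))
  | .or => .skip

/-- Processes a symbol of the CNF part of the input or the separator. -/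
def cnfSymb : Symb → Prog
  | .bit b => .push cnf' (.bit b)
  | .endVar => .push cnf' .endVar
  | .endGroup => .seq (.push cnf' .endGroup) (.push col .zero)
  | .or => .seq (.loop cnf' fun s => .push cnf s)
      -- Every conjunction will add one more mark to `cnt`, so that there are `|D| + 1` rounds.
      (.seq (.push cnt ()) (.set fun r => { r with afterOr := true }))

/-- Processes a symbol of the input. -/
def inpSymb (s : Symb) : Prog :=
  .read fun r => if r.afterOr then dnfSymb s else cnfSymb s

/-- Computes the column sums. -/
def sumSymb : Cell ⊕ Bool → Prog
  | .inl e => .seq (.push mat' (.inl e)) (.pop col fun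
      | none => .skip
      | some a => .push col' (a.add e))
  | .inr o => .seq (.push mat' (.inr o)) (.loop col' fun e => .push col e)

/-- Updates an entry of a row; the argument says whether a variable of the row is forced. -/
def updateCell (f : Bool) (e : Cell) : Prog :=
  .pop col' fun
    | none => .skip
    | some a => .seq (.push col a) (.push buf' (if f ∧ a = .many then .zero else e))

/-- Propagates within the rows. -/
def propagateSymb : Cell ⊕ Bool → Prog
  | .inl e => .pop col fun
      | none => .skip
      | some a => .seq (.push col' a) (.seq (.push buf e)
          (.set fun r => { r with acc := if a = .many then r.acc.add e else r.acc }))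
  | .inr o => .read fun r => .seq
      -- Whether the row fires is known only after all its entries have been read, which is why they
      -- were buffered.
      (.loop buf (updateCell (!o && r.acc = .one)))
      (.seq (.loop buf' fun e => .push mat' (.inl e))
        (.seq (.push mat' (.inr (o || (!o && r.acc = .one))))
          (.set fun r => { r with
            acc := .zero, conflict := r.conflict || (!o && r.acc = .zero) })))

/-- Records whether a column sum is zero. -/
def checkCell (a : Cell) : Prog :=
  .seq (.push col' a) (.set fun r => { r with conflict := r.conflict || a = .zero })

/-- One round of unit propagation. -/
def propagate : Prog :=
  .seq (.loop mat sumSymb) (.seq (.loop mat' fun s => .push mat s)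
    (.seq (.loop col checkCell)
      (.seq (.loop col' fun a => .push col a) (.seq (.loop mat propagateSymb)
        -- The column sums are replaced by zeros, from which the next round starts.
        (.seq (.loop mat' fun s => .push mat s) (.seq (.loop col fun _ => .push col' .zero)
          (.loop col' fun a => .push col a)))))))

/-- Looks for a row with both zero and non-zero entries. -/
def mixedSymb : Cell ⊕ Bool → Prog
  | .inl e => .set fun r => { r with
      hasZero := r.hasZero || e = .zero, hasNonzero := r.hasNonzero || e ≠ .zero }
  | .inr _ => .set fun r => { r with
      hasZero := false, hasNonzero := false, mixed := r.mixed || (r.hasZero && r.hasNonzero) }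

/-- The whole program. -/
def main : Prog :=
  .seq (.loop inp inpSymb) (.seq (.loop mat' fun s => .push mat s)
    (.seq (.loop cnt fun _ => propagate) (.seq (.loop mat mixedSymb)
      -- `haltList` requires all stacks other than `out` to be empty.
      (.seq (.loop cnf fun _ => .skip) (.seq (.loop col fun _ => .skip)
        (.read fun r => .push out (r.conflict || !r.mixed)))))))

end Machine

end ReadOnce

namespace ReadOnce

/-! ### Looking up a variable in the CNF -/

namespace Machine

open Stack

variable (r : Reg) (S : Store)

theorem pass_compareBit : ∀ (ys xs zs : List Bool) (s : Bool),
    Pass y compareBit 3 ys { r with same := s } { S with y := ys, x := xs, x' := zs }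
      { r with same := s && decide (xs.take ys.length = ys) }
      { S with y := [], x := xs.drop ys.length, x' := (xs.take ys.length).reverse ++ zs }
  | [], xs, zs, s => by simpa using Pass.nil
  | b :: ys, [], zs, s => by
    refine Pass.cons rfl ((Run.pop_nil rfl .set).mono (by omega)) ?_
    simpa using pass_compareBit ys [] zs false
  | b :: ys, b' :: xs, zs, s => by
    refine Pass.cons rfl (Run.pop_cons (a := b') (l := xs) rfl (.seq .push .set)) ?_
    have h : (s && decide ((b' :: xs).take (b :: ys).length = b :: ys)) =
        ((s && b' == b) && decide (xs.take ys.length = ys)) := by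
      rw [Bool.eq_iff_iff]
      simp [and_assoc]
    rw [h]
    simpa using pass_compareBit ys xs (b' :: zs) (s && b' == b)

theorem run_compare {n : ℕ} {xs ys : List Bool} (hx : xs.length ≤ n) (hy : ys.length ≤ n) :
    Run compare { r with same := true } { S with y := ys, x := xs, x' := [] }
      { r with same := decide (xs = ys) } { S with y := [], x := xs, x' := [] } (6 * n + 5) := by
  have h1 := (pass_compareBit r S ys xs [] true).run rfl
  have hd : xs.take ys.length ++ xs.drop ys.length = xs := List.take_append_drop _ _
  have hlen : (xs.take ys.length).length ≤ n := (List.length_take_le' _ _).trans hx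
  have hlen' : (xs.drop ys.length).length = xs.length - ys.length := List.length_drop
  generalize xs.take ys.length = u at h1 hd hlen hlen'
  generalize xs.drop ys.length = v at h1 hd hlen'
  subst hd
  cases v with
  | nil =>
    refine Run.congr (.seq h1 (.seq (.pop_nil rfl .skip) (.move (by decide) _))) ?_ ?_ ?_
    · simp
    · simp
    · simp
      omega
  -- A non-empty remainder makes the lengths differ, so clearing `same` is right even if the
  -- prefixes agree.
  | cons a v =>
    refine Run.congr (.seq h1 (.seq (.pop_cons rfl (.seq .push .set)) (.move (by decide) _)))
      ?_ ?_ ?_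
    · have : u ++ a :: v ≠ ys := by
        rintro rfl
        simp at hlen'
      simp [this]
    · simp
    · simp
      omega

/-- The time for a symbol of the CNF when a variable is looked up. -/
def scanTime {R : Type} [Semiring R] (n : R) : R := 6 * n + 10

/-- The register while a variable is looked up. -/
abbrev scanReg (o h f : Bool) : Reg :=
  { afterOr := true, outside := o, hit := h, found := f }

/-- The stacks while the variable `v` is looked up. -/
abbrev scanStore (p p' : List Symb) (v : ℕ) (l l' : List Cell) : Store :=
  { S with
    cnf := p, cnf' := p', x := (Computability.encodeNat v).reverse, x' := [], y := [], col := l,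
    col' := l' }

theorem encodeNat_injective : Function.Injective Computability.encodeNat :=
  Function.LeftInverse.injective Computability.decode_encodeNat

theorem pass_scan_bits {T : ℕ} (hT : 2 ≤ T) (q : List Symb) : ∀ (l : List Bool) (w : List Symb)
    (w' : List Bool),
    Pass cnf scanSymb T (l.map .bit) r { S with cnf := l.map .bit ++ q, cnf' := w, y := w' }
      r { S with cnf := q, cnf' := (l.map .bit).reverse ++ w, y := l.reverse ++ w' }
  | [], w, w' => by simpa using Pass.nil
  | b :: l, w, w' => by
    refine Pass.cons rfl ((Run.seq .push .push).mono hT) ?_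
    simpa using pass_scan_bits hT q l (.bit b :: w) (b :: w')

theorem pass_scan_var {n v u : ℕ} (hv : (encodeVar v).length ≤ n) (hu : (encodeVar u).length ≤ n)
    (q w : List Symb) (l l' : List Cell) (o h f : Bool) :
    Pass cnf scanSymb (scanTime n) (encodeVar u) (scanReg o h f)
      (scanStore S (encodeVar u ++ q) w v l l')
      (scanReg o (h || decide (v = u)) (f || decide (v = u)))
      (scanStore S q ((encodeVar u).reverse ++ w) v l l') := by
  simp only [encodeVar, List.length_append, List.length_map, List.length_singleton] at hv hu
  have h1 := pass_scan_bits (scanReg o h f) (scanStore S [] w v l l') (T := scanTime n)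
    (by simp only [scanTime]; omega) (.endVar :: q) (Computability.encodeNat u) w []
  -- Both words are reversed on their stacks, since their bits were pushed in reading order.
  have h2 := run_compare (n := n) (scanReg o h f)
    (scanStore S q (.endVar :: (((Computability.encodeNat u).map .bit).reverse ++ w)) v l l')
    (xs := (Computability.encodeNat v).reverse) (ys := (Computability.encodeNat u).reverse)
    (by simp; omega) (by simp; omega)
  have he : ((Computability.encodeNat v).reverse = (Computability.encodeNat u).reverse) = (v = u) := by
    rw [List.reverse_inj, encodeNat_injective.eq_iff]
  simp only [he] at h2
  have h3 : Run (scanSymb .endVar) (scanReg o h f)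
      { scanStore S q (((Computability.encodeNat u).map .bit).reverse ++ w) v l l' with
        y := (Computability.encodeNat u).reverse }
      (scanReg o (h || decide (v = u)) (f || decide (v = u)))
      (scanStore S q ((encodeVar u).reverse ++ w) v l l') (scanTime n) := by
    refine Run.congr (.seq .push (.seq h2 .set)) ?_ ?_ ?_
    · simp
    · simp [encodeVar]
    · simp only [scanTime]
      omega
  have h4 := h1.append (Pass.single (l := q) (a := Symb.endVar) rfl (by simpa using h3))
  simpa [encodeVar] using h4

theorem pass_scan_vars {n v : ℕ} (hv : (encodeVar v).length ≤ n) (q : List Symb)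
    (l l' : List Cell) (o : Bool) : ∀ (c : List ℕ) (_ : ∀ u ∈ c, (encodeVar u).length ≤ n)
    (w : List Symb) (h f : Bool),
    Pass cnf scanSymb (scanTime n) (c.flatMap encodeVar) (scanReg o h f)
      (scanStore S (c.flatMap encodeVar ++ q) w v l l')
      (scanReg o (h || decide (v ∈ c)) (f || decide (v ∈ c)))
      (scanStore S q ((c.flatMap encodeVar).reverse ++ w) v l l')
  | [], _, w, h, f => by simpa using Pass.nil
  | u :: c, hc, w, h, f => by
    have h1 := pass_scan_var S hv (hc u List.mem_cons_self) (c.flatMap encodeVar ++ q) w l l' o h f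
    have h2 := pass_scan_vars hv q l l' o c (fun u hu => hc u (List.mem_cons_of_mem _ hu))
      ((encodeVar u).reverse ++ w) (h || decide (v = u)) (f || decide (v = u))
    simpa [Bool.or_assoc] using h1.append h2

/-- The string for a clause or a conjunction. -/
abbrev encodeGroup (c : List ℕ) : List Symb :=
  c.flatMap encodeVar ++ [.endGroup]

/-- The counts `g` are arbitrary because the variables of a conjunction are looked up one after
another on top of the earlier counts. The flag `hit` is reset at each clause, whereas `found`
persists. -/
theorem pass_scan_groups {n v : ℕ} (hv : (encodeVar v).length ≤ n) (q : List Symb) (o : Bool)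
    (g : List ℕ → ℕ) : ∀ (C : Groups) (_ : ∀ c ∈ C, ∀ u ∈ c, (encodeVar u).length ≤ n)
    (w : List Symb) (l' : List Cell) (f : Bool),
    Pass cnf scanSymb (scanTime n) (encodeGroups C) (scanReg o false f)
      (scanStore S (encodeGroups C ++ q) w v (C.map fun c => .sat (g c)) l')
      (scanReg o false (f || decide (∃ c ∈ C, v ∈ c)))
      (scanStore S q ((encodeGroups C).reverse ++ w) v []
        ((C.map fun c => Cell.sat (g c + if v ∈ c then 1 else 0)).reverse ++ l'))
  | [], _, w, l', f => by simpa [encodeGroups] using Pass.nil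
  | c :: C, hC, w, l', f => by
    have h1 := pass_scan_vars S hv (.endGroup :: (encodeGroups C ++ q))
      ((c :: C).map fun c => .sat (g c)) l' o c (hC c List.mem_cons_self) w false f
    have h2 : Run (scanSymb .endGroup) (scanReg o (decide (v ∈ c)) (f || decide (v ∈ c)))
        (scanStore S (encodeGroups C ++ q) ((c.flatMap encodeVar).reverse ++ w) v
          ((c :: C).map fun c => .sat (g c)) l')
        (scanReg o false (f || decide (v ∈ c)))
        (scanStore S (encodeGroups C ++ q) ((encodeGroup c).reverse ++ w) v
          (C.map fun c => .sat (g c)) (Cell.sat (g c + if v ∈ c then 1 else 0) :: l'))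
        (scanTime n) := by
      refine Run.congr (.seq .push (.pop_cons rfl (.read (.seq .push .set)))) ?_ ?_ ?_
      · rfl
      · by_cases hvc : v ∈ c
        · simp [hvc, Cell.sat_add]
          rfl
        · simp [hvc]
      · simp only [scanTime]
        omega
    have h3 := pass_scan_groups hv q o g C (fun c hc => hC c (List.mem_cons_of_mem _ hc))
      ((encodeGroup c).reverse ++ w) (Cell.sat (g c + if v ∈ c then 1 else 0) :: l')
      (f || decide (v ∈ c))
    have h4 := h1.append ((Pass.single (l := encodeGroups C ++ q) (a := Symb.endGroup) rfl
      (by simpa using h2)).append h3)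
    simpa [encodeGroups, Bool.or_assoc] using h4

end Machine

end ReadOnce

namespace ReadOnce

/-! ### Reading the input and building the matrix -/

namespace Machine

open Stack

/-- The time for a symbol of the input. -/
def inpTime {R : Type} [Semiring R] (n : R) : R := n * (scanTime n + 1) + 6 * n + 20

/-- The register while the DNF is read. -/
abbrev dnfReg (o : Bool) : Reg :=
  { afterOr := true, outside := o }

/-- The stacks while the DNF is read. -/
abbrev dnfStore (C : Groups) (p : List Symb) (l : List Bool) (g : List ℕ → ℕ)
    (M : List (Cell ⊕ Bool)) (k : List Unit) : Store :=
  { inp := p, cnf := encodeGroups C, x := l, col := C.map fun c => .sat (g c), mat' := M, cnt := k }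

theorem length_encodeVar_le {C : Groups} {c : List ℕ} (hc : c ∈ C) {u : ℕ} (hu : u ∈ c) :
    (encodeVar u).length ≤ (encodeGroups C).length := by
  refine List.Sublist.length_le ?_
  have h1 : (encodeVar u).Sublist (c.flatMap encodeVar) :=
    List.sublist_flatten_of_mem (List.mem_map_of_mem hu)
  have h2 : (c.flatMap encodeVar ++ [Symb.endGroup]).Sublist (encodeGroups C) :=
    List.sublist_flatten_of_mem (List.mem_map_of_mem (f := fun c : List ℕ => c.flatMap encodeVar ++ [Symb.endGroup]) hc)
  exact (h1.trans (List.sublist_append_left _ _)).trans h2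

theorem length_le_length_encodeGroups : ∀ C : Groups, C.length ≤ (encodeGroups C).length
  | [] => by simp
  | c :: C => by
    have := length_le_length_encodeGroups C
    simp only [encodeGroups, List.flatMap_cons, List.length_append, List.length_cons] at this ⊢
    omega

variable {C : Groups} {n : ℕ}

/-- One scan of the whole CNF per variable occurrence; this accounts for the quadratic term of
`inpTime`. -/
theorem run_dnfSymb_endVar (hC : (encodeGroups C).length ≤ n) {v : ℕ}
    (hv : (encodeVar v).length ≤ n) (q : List Symb) (g : List ℕ → ℕ) (M : List (Cell ⊕ Bool))
    (k : List Unit) (o : Bool) :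
    Run (inpSymb .endVar) (dnfReg o) (dnfStore C q (Computability.encodeNat v).reverse g M k)
      (dnfReg (o || decide (∀ c ∈ C, v ∉ c)))
      (dnfStore C q [] (fun c => g c + if v ∈ c then 1 else 0) M k) (inpTime n) := by
  have h1 := pass_scan_groups { inp := q, mat' := M, cnt := k } hv [] o g C
    (fun c hc u hu => (length_encodeVar_le hc hu).trans hC) [] [] false
  have h2 := h1.run rfl
  rw [List.append_nil] at h2
  have hk := length_le_length_encodeGroups C
  refine Run.read (t := n * (scanTime n + 1) + 6 * n + 19) (Run.congr (.seq h2 (.seq (.move (by decide) _) (.seq (.move (by decide) _)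
    (.seq .clear .set)))) ?_ ?_ ?_)
  · by_cases h : ∃ c ∈ C, v ∈ c
    · have : ¬ ∀ c ∈ C, v ∉ c := by push Not; exact h
      simp [h]
    · have : ∀ c ∈ C, v ∉ c := by push Not at h; exact h
      simpa [h] using Or.inr this
  · simp
  · simp only [encodeVar, List.length_append, List.length_map, List.length_singleton] at hv
    have := Nat.mul_le_mul_right (scanTime n + 1) hC
    simp
    omega

theorem pass_inp_bits (q : List Symb) (g : List ℕ → ℕ) (M : List (Cell ⊕ Bool))
    (k : List Unit) (o : Bool) : ∀ l l' : List Bool,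
    Pass inp inpSymb (inpTime n) (l.map .bit) (dnfReg o) (dnfStore C (l.map .bit ++ q) l' g M k)
      (dnfReg o) (dnfStore C q (l.reverse ++ l') g M k)
  | [], l' => by simpa using Pass.nil
  | b :: l, l' => by
    refine Pass.cons rfl (Run.mono (.read .push) ?_) ?_
    · simp only [inpTime]
      omega
    · simpa using pass_inp_bits q g M k o l (b :: l')

theorem pass_inp_vars (hC : (encodeGroups C).length ≤ n) (q : List Symb) (M : List (Cell ⊕ Bool))
    (k : List Unit) : ∀ (d : List ℕ) (_ : ∀ u ∈ d, (encodeVar u).length ≤ n) (g : List ℕ → ℕ)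
    (o : Bool),
    Pass inp inpSymb (inpTime n) (d.flatMap encodeVar) (dnfReg o)
      (dnfStore C (d.flatMap encodeVar ++ q) [] g M k)
      (dnfReg (o || d.any fun v => decide (∀ c ∈ C, v ∉ c)))
      (dnfStore C q [] (fun c => g c + d.countP (· ∈ c)) M k)
  | [], _, g, o => by simpa using Pass.nil
  | v :: d, hd, g, o => by
    have h1 := pass_inp_bits (C := C) (n := n) (.endVar :: (d.flatMap encodeVar ++ q)) g M k o
      (Computability.encodeNat v) []
    have h2 := run_dnfSymb_endVar hC (hd v List.mem_cons_self) (d.flatMap encodeVar ++ q) g M k o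
    have h3 := pass_inp_vars hC q M k d (fun u hu => hd u (List.mem_cons_of_mem _ hu))
      (fun c => g c + if v ∈ c then 1 else 0) (o || decide (∀ c ∈ C, v ∉ c))
    have h4 := h1.append ((Pass.single (l := d.flatMap encodeVar ++ q) (a := Symb.endVar) rfl
      (by simpa using h2)).append h3)
    have h5 : (fun c : List ℕ => (g c + if v ∈ c then 1 else 0) + d.countP (· ∈ c)) =
        fun c => g c + (v :: d).countP (· ∈ c) := by
      funext c
      rw [List.countP_cons]
      simp only [decide_eq_true_eq]
      omega
    rw [h5] at h4
    simpa [encodeVar, Bool.or_assoc] using h4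

/-- The zeros pushed meanwhile are the fresh counters for the next conjunction. -/
theorem pass_emitCell (r : Reg) (S : Store) : ∀ (l l' : List Cell) (M : List (Cell ⊕ Bool)),
    Pass col emitCell 2 l r { S with col := l, col' := l', mat' := M } r
      { S with
        col := [], col' := List.replicate l.length .zero ++ l', mat' := (l.map .inl).reverse ++ M }
  | [], l', M => by simpa using Pass.nil
  | e :: l, l', M => by
    refine Pass.cons rfl (Run.seq .push .push) ?_
    have h : List.replicate l.length Cell.zero ++ .zero :: l' =
        List.replicate (e :: l).length .zero ++ l' := by
      rw [List.length_cons, List.replicate_succ', List.append_assoc, List.singleton_append]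
    simpa [h] using pass_emitCell r S l (.zero :: l') (.inl e :: M)

/-- The string for a row of the matrix. -/
def encodeRow (r : Row) : List (Cell ⊕ Bool) :=
  r.1.map .inl ++ [.inr r.2]

/-- The string for the matrix. -/
def encodeRows (R : List Row) : List (Cell ⊕ Bool) :=
  R.flatMap encodeRow

theorem run_dnfSymb_endGroup (hC : (encodeGroups C).length ≤ n) (q : List Symb)
    (M : List (Cell ⊕ Bool)) (k : List Unit) (d : List ℕ) :
    Run (inpSymb .endGroup) (dnfReg (rowOf C d).2)
      (dnfStore C q [] (fun c => d.countP (· ∈ c)) M k) (dnfReg false)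
      (dnfStore C q [] (fun _ => 0) ((encodeRow (rowOf C d)).reverse ++ M) (() :: k))
      (inpTime n) := by
  have h1 := (pass_emitCell (dnfReg (rowOf C d).2)
    (dnfStore C q [] (fun c => d.countP (· ∈ c)) M k)
    (C.map fun c => .sat (d.countP (· ∈ c))) [] M).run rfl
  have hk := length_le_length_encodeGroups C
  refine Run.mono (t := 6 * n + 20) (Run.read (Run.congr
    (.seq h1 (.seq (.move (by decide) _) (.read (.seq .push (.seq .push .set))))) ?_ ?_ ?_)) ?_
  · rfl
  · simp [encodeRow, rowOf, List.map_const', Cell.sat]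
  · simp
    omega
  · simp only [inpTime]
    omega

theorem pass_inp_dnf (hC : (encodeGroups C).length ≤ n) : ∀ (D : Groups)
    (_ : (encodeGroups D).length ≤ n) (M : List (Cell ⊕ Bool)) (k : List Unit),
    Pass inp inpSymb (inpTime n) (encodeGroups D) (dnfReg false)
      (dnfStore C (encodeGroups D) [] (fun _ => 0) M k) (dnfReg false)
      (dnfStore C [] [] (fun _ => 0) ((encodeRows (matrix C D)).reverse ++ M)
        (List.replicate D.length () ++ k))
  | [], _, M, k => by simpa [encodeGroups, encodeRows, matrix] using Pass.nil
  | d :: D, hD, M, k => by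
    have hD' : (encodeGroups D).length ≤ n := by
      simp only [encodeGroups, List.flatMap_cons, List.length_append] at hD ⊢
      omega
    have h1 := pass_inp_vars hC (.endGroup :: encodeGroups D) M k d
      (fun u hu => (length_encodeVar_le List.mem_cons_self hu).trans hD) (fun _ => 0) false
    simp only [Nat.zero_add, Bool.false_or] at h1
    have h2 := run_dnfSymb_endGroup hC (encodeGroups D) M k d
    have h3 := pass_inp_dnf hC D hD' ((encodeRow (rowOf C d)).reverse ++ M) (() :: k)
    have h4 := h1.append ((Pass.single (l := encodeGroups D) (a := Symb.endGroup) rfl h2).append h3)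
    have h5 : List.replicate D.length () ++ () :: k = List.replicate (d :: D).length () ++ k := by
      rw [List.length_cons, List.replicate_succ', List.append_assoc, List.singleton_append]
    rw [h5] at h4
    simpa [encodeGroups, encodeRows, matrix] using h4

/-- The stacks while the CNF is read. -/
abbrev cnfStore (p q : List Symb) (l : List Cell) : Store :=
  { inp := p, cnf' := q, col := l }

theorem pass_inp_cnf_symbols (hn : 3 ≤ n) (q : List Symb) (l : List Cell) : ∀ (p w : List Symb)
    (_ : ∀ s ∈ p, s = .endVar ∨ ∃ b, s = .bit b),
    Pass inp inpSymb n p {} (cnfStore (p ++ q) w l) {} (cnfStore q (p.reverse ++ w) l)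
  | [], w, _ => by simpa using Pass.nil
  | s :: p, w, h => by
    have ih := pass_inp_cnf_symbols hn q l p (s :: w) (fun s hs => h s (List.mem_cons_of_mem _ hs))
    have h1 : Run (inpSymb s) {} (cnfStore (p ++ q) w l) {} (cnfStore (p ++ q) (s :: w) l) n := by
      rcases h s List.mem_cons_self with rfl | ⟨b, rfl⟩
      · exact Run.mono (.read .push) (by omega)
      · exact Run.mono (.read .push) (by omega)
    refine Pass.cons rfl h1 ?_
    simpa using ih

theorem pass_inp_cnf (hn : 3 ≤ n) (q : List Symb) : ∀ (C : Groups) (w : List Symb) (l : List Cell),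
    Pass inp inpSymb n (encodeGroups C) {} (cnfStore (encodeGroups C ++ q) w l) {}
      (cnfStore q ((encodeGroups C).reverse ++ w) (List.replicate C.length .zero ++ l))
  | [], w, l => by simpa [encodeGroups] using Pass.nil
  | c :: C, w, l => by
    have h1 := pass_inp_cnf_symbols hn (.endGroup :: (encodeGroups C ++ q)) l
      (c.flatMap encodeVar) w (by
        intro s hs
        obtain ⟨v, -, hs⟩ := List.mem_flatMap.1 hs
        simp only [encodeVar, List.mem_append, List.mem_map, List.mem_singleton] at hs
        rcases hs with ⟨b, -, rfl⟩ | rfl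
        · exact .inr ⟨b, rfl⟩
        · exact .inl rfl)
    have h2 : Run (inpSymb .endGroup) {}
        (cnfStore (encodeGroups C ++ q) ((c.flatMap encodeVar).reverse ++ w) l) {}
        (cnfStore (encodeGroups C ++ q) ((encodeGroup c).reverse ++ w) (.zero :: l)) n := by
      refine Run.congr (.read (.seq .push .push)) rfl ?_ (by omega)
      simp
    have h3 := pass_inp_cnf hn q C ((encodeGroup c).reverse ++ w) (.zero :: l)
    have h4 := h1.append ((Pass.single (l := encodeGroups C ++ q) (a := Symb.endGroup) rfl
      (by simpa using h2)).append h3)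
    have h5 : List.replicate C.length Cell.zero ++ .zero :: l =
        List.replicate (c :: C).length .zero ++ l := by
      rw [List.length_cons, List.replicate_succ', List.append_assoc, List.singleton_append]
    rw [h5] at h4
    simpa [encodeGroups] using h4

/-- Reading the input. -/
theorem run_inp {E : Expression} (hE : (encodeExpression E).length ≤ n) :
    Run (.loop inp inpSymb) {} { inp := encodeExpression E } (dnfReg false)
      (dnfStore E.cnf [] [] (fun _ => 0) (encodeRows (matrix E.cnf E.dnf)).reverse
        (List.replicate (E.dnf.length + 1) ())) (n * (inpTime n + 1) + 1) := by
  have hlen : (encodeGroups E.cnf).length ≤ n ∧ (encodeGroups E.dnf).length ≤ n := by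
    simp only [encodeExpression, List.length_append, List.length_cons] at hE
    omega
  -- The weak bound `inpTime n` is used here as well, so that all passes of the loop share one
  -- bound.
  have h1 := (pass_inp_cnf (n := inpTime n) (by simp only [inpTime]; omega)
    (.or :: encodeGroups E.dnf) E.cnf [] [])
  have h2 : Run (inpSymb .or) {}
      (cnfStore (encodeGroups E.dnf) ((encodeGroups E.cnf).reverse ++ [])
        (List.replicate E.cnf.length .zero ++ [])) (dnfReg false)
      (dnfStore E.cnf (encodeGroups E.dnf) [] (fun _ => 0) [] [()]) (inpTime n) := by
    refine Run.mono (t := 2 * n + 10) (.read (Run.congr (.seq (.move (by decide) _) (.seq .push .set))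
      ?_ ?_ ?_)) ?_
    · rfl
    · simp [List.map_const', Cell.sat]
    · simp
      omega
    · simp only [inpTime]
      omega
  have h3 := pass_inp_dnf hlen.1 E.dnf hlen.2 [] [()]
  have h4 := h1.append ((Pass.single (l := encodeGroups E.dnf) (a := Symb.or) rfl h2).append h3)
  have h5 : List.replicate E.dnf.length () ++ [()] = List.replicate (E.dnf.length + 1) () :=
    List.replicate_succ'.symm
  rw [h5, List.append_nil] at h4
  refine Run.mono (h4.run rfl) (Nat.add_le_add_right (Nat.mul_le_mul_right _ ?_) 1)
  simpa [encodeExpression] using hE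

end Machine

end ReadOnce

namespace ReadOnce

/-! ### Execution and time of one propagation round -/

namespace Machine

open Stack

variable {n : ℕ} (r : Reg) (S : Store)

theorem pass_sumSymb_cells (hn : 3 ≤ n) (q : List (Cell ⊕ Bool)) : ∀ (es s l' : List Cell)
    (M : List (Cell ⊕ Bool)) (_ : es.length = s.length),
    Pass mat sumSymb n (es.map .inl) r
      { S with col := s, col' := l', mat := es.map .inl ++ q, mat' := M } r
      { S with
        col := [], col' := (List.zipWith Cell.add s es).reverse ++ l', mat := q
        mat' := (es.map .inl).reverse ++ M }
  | [], [], l', M, _ => by simpa using Pass.nil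
  | e :: es, a :: s, l', M, h => by
    refine Pass.cons rfl (Run.mono (.seq .push (.pop_cons rfl .push)) hn) ?_
    simpa using pass_sumSymb_cells hn q es s (a.add e :: l') (.inl e :: M) (by simpa using h)

theorem pass_sumSymb_rows (q : List (Cell ⊕ Bool)) : ∀ (R : List Row) (s : List Cell)
    (M : List (Cell ⊕ Bool)) (_ : ∀ r ∈ R, r.1.length = s.length) (_ : s.length ≤ n),
    Pass mat sumSymb (2 * n + 3) (encodeRows R) r
      { S with col := s, col' := [], mat := encodeRows R ++ q, mat' := M } r
      { S with
        col := Row.colSums s R, col' := [], mat := q, mat' := (encodeRows R).reverse ++ M }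
  | [], s, M, _, _ => by simpa [encodeRows, Row.colSums] using Pass.nil
  | (es, o) :: R, s, M, h, hs => by
    rw [List.forall_mem_cons] at h
    have h1 := pass_sumSymb_cells (n := 2 * n + 3) r S (by omega) (.inr o :: (encodeRows R ++ q))
      es s [] M h.1
    have hlen : (List.zipWith Cell.add s es).length = s.length := by
      simp only [List.length_zipWith]
      have := h.1
      simp only at this
      omega
    have h2 : Run (sumSymb (.inr o)) r
        { S with
          col := [], col' := (List.zipWith Cell.add s es).reverse, mat := encodeRows R ++ q
          mat' := (es.map .inl).reverse ++ M } r
        { S with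
          col := List.zipWith Cell.add s es, col' := [], mat := encodeRows R ++ q
          mat' := (encodeRow (es, o)).reverse ++ M } (2 * n + 3) := by
      refine Run.congr (.seq .push (.move (by decide) _)) rfl ?_ ?_
      · simp [encodeRow]
      · simp [hlen, -List.length_zipWith]
        omega
    have h3 := pass_sumSymb_rows q R (List.zipWith Cell.add s es)
      ((encodeRow (es, o)).reverse ++ M) (fun r hr => (h.2 r hr).trans hlen.symm) (by omega)
    have h4 := h1.append ((Pass.single (l := encodeRows R ++ q) (a := Sum.inr o) rfl
      (by simpa using h2)).append h3)
    simpa [encodeRows, encodeRow, Row.colSums] using h4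

theorem pass_checkCell : ∀ (l l' : List Cell) (c : Bool),
    Pass col checkCell 2 l { r with conflict := c } { S with col := l, col' := l' }
      { r with conflict := c || l.any (· = .zero) } { S with col := [], col' := l.reverse ++ l' }
  | [], l', c => by simpa using Pass.nil
  | a :: l, l', c => by
    refine Pass.cons rfl (Run.seq .push .set) ?_
    simpa [Bool.or_assoc] using pass_checkCell l (a :: l') (c || a = .zero)

theorem pass_propagateSymb_cells (hn : 4 ≤ n) (q : List (Cell ⊕ Bool)) :
    ∀ (es s l' B : List Cell) (a : Cell) (_ : es.length = s.length),
    Pass mat propagateSymb n (es.map .inl) { r with acc := a }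
      { S with col := s, col' := l', buf := B, mat := es.map .inl ++ q }
      { r with acc := Row.restSum a s es }
      { S with col := [], col' := s.reverse ++ l', buf := es.reverse ++ B, mat := q }
  | [], [], l', B, a, _ => by simpa [Row.restSum] using Pass.nil
  | e :: es, b :: s, l', B, a, h => by
    refine Pass.cons rfl (Run.mono (.pop_cons rfl (.seq .push (.seq .push .set))) hn) ?_
    simpa [Row.restSum] using pass_propagateSymb_cells hn q es s (b :: l') (e :: B)
      (if b = .many then a.add e else a) (by simpa using h)

theorem pass_updateCell (f : Bool) : ∀ (es s l B : List Cell) (_ : es.length = s.length),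
    Pass buf (updateCell f) 3 es r { S with col := l, col' := s, buf := es, buf' := B } r
      { S with
        col := s.reverse ++ l, col' := [], buf := []
        buf' := (List.zipWith (fun a e => if f ∧ a = .many then .zero else e) s es).reverse ++ B }
  | [], [], l, B, _ => by simpa using Pass.nil
  | e :: es, a :: s, l, B, h => by
    refine Pass.cons rfl (Run.pop_cons rfl (.seq .push .push)) ?_
    simpa using pass_updateCell f es s (a :: l) ((if f ∧ a = .many then .zero else e) :: B)
      (by simpa using h)

/-- The register during unit propagation. -/
abbrev matReg (c : Bool) (a : Cell) : Reg :=
  { afterOr := true, conflict := c, acc := a }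

theorem pass_propagateSymb_rows (q : List (Cell ⊕ Bool)) (s : List Cell) (hs : s.length ≤ n) :
    ∀ (R : List Row) (M : List (Cell ⊕ Bool)) (c : Bool) (_ : ∀ r ∈ R, r.1.length = s.length),
    Pass mat propagateSymb (6 * n + 10) (encodeRows R) (matReg c .zero)
      { S with col := s, col' := [], buf := [], buf' := [], mat := encodeRows R ++ q, mat' := M }
      (matReg (c || R.any fun r => !r.2 && Row.restSum .zero s r.1 = .zero) .zero)
      { S with
        col := s, col' := [], buf := [], buf' := [], mat := q
        mat' := (encodeRows (R.map (Row.update s))).reverse ++ M }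
  | [], M, c, _ => by simpa [encodeRows] using Pass.nil
  | (es, o) :: R, M, c, h => by
    rw [List.forall_mem_cons] at h
    have hlen : es.length = s.length := h.1
    have h1 := pass_propagateSymb_cells (n := 6 * n + 10) (matReg c .zero)
      { S with buf' := [], mat' := M } (by omega) (.inr o :: (encodeRows R ++ q)) es s [] []
      .zero hlen
    -- The buffered row and the saved column sums are both reversed, so columns stay aligned because
    -- the lengths agree.
    have h2 := (pass_updateCell (matReg c (Row.restSum .zero s es))
      { S with mat := encodeRows R ++ q, mat' := M }
      (!o && Row.restSum .zero s es = .one) es.reverse s.reverse [] [] (by simpa using hlen)).run rfl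
    have h3 : Run (propagateSymb (.inr o)) (matReg c (Row.restSum .zero s es))
        { S with
          col := [], col' := s.reverse, buf := es.reverse, buf' := [], mat := encodeRows R ++ q
          mat' := M }
        (matReg (c || (!o && Row.restSum .zero s es = .zero)) .zero)
        { S with
          col := s, col' := [], buf := [], buf' := [], mat := encodeRows R ++ q
          mat' := (encodeRow (Row.update s (es, o))).reverse ++ M } (6 * n + 10) := by
      refine Run.congr (.read (.seq h2 (.seq (.move (by decide) _) (.seq .push .set)))) ?_ ?_ ?_
      · rfl
      · simp [encodeRow, Row.update, Row.fires, List.reverse_zipWith hlen.symm]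
      · simp [hlen]
        omega
    have h4 := pass_propagateSymb_rows q s hs R ((encodeRow (Row.update s (es, o))).reverse ++ M)
      (c || (!o && Row.restSum .zero s es = .zero)) h.2
    have h5 := h1.append ((Pass.single (l := encodeRows R ++ q) (a := Sum.inr o) rfl
      (by simpa using h3)).append h4)
    simpa [encodeRows, encodeRow, Bool.or_assoc] using h5

theorem length_encodeRows {k : ℕ} : ∀ (R : List Row) (_ : ∀ r ∈ R, r.1.length = k),
    (encodeRows R).length = R.length * (k + 1)
  | [], _ => by simp [encodeRows]
  | r :: R, h => by
    rw [List.forall_mem_cons] at h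
    have := length_encodeRows R h.2
    simp only [encodeRows] at this
    simp [encodeRows, encodeRow, h.1, this]
    ring

theorem length_colSums {s : List Cell} : ∀ {R : List Row} (_ : ∀ r ∈ R, r.1.length = s.length),
    (Row.colSums s R).length = s.length
  | [], _ => rfl
  | r :: R, h => by
    rw [List.forall_mem_cons] at h
    have hlen : (List.zipWith Cell.add s r.1).length = s.length := by
      rw [List.length_zipWith, h.1, min_self]
    exact (length_colSums (s := List.zipWith Cell.add s r.1) (R := R)
      fun r' hr' => (h.2 r' hr').trans hlen.symm).trans hlen

theorem length_of_mem_propagate {z : List Cell} {R : List Row} (h : ∀ r ∈ R, r.1.length = z.length) :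
    ∀ r ∈ Row.propagate z R, r.1.length = z.length := by
  simp only [Row.propagate, List.forall_mem_map]
  intro r hr
  rw [Row.update, List.length_zipWith, length_colSums h, h r hr, min_self]

/-- The time for a round of unit propagation on a matrix whose string has length at most `m`. -/
def propagateTime {R : Type} [Semiring R] (n m : R) : R :=
  m * (2 * n + 4) + m * (6 * n + 11) + 4 * m + 9 * n + 10

/-- The stacks between the rounds of unit propagation. -/
abbrev matStore (p : List Symb) (l : List Cell) (R : List Row) (k : List Unit) : Store :=
  { cnf := p, col := l, mat := encodeRows R, cnt := k }

theorem run_propagate {m : ℕ} (p : List Symb) (k : List Unit) {z : List Cell}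
    (hz : z = List.replicate z.length .zero) (hzn : z.length ≤ n) {R : List Row}
    (hR : ∀ r ∈ R, r.1.length = z.length) (hm : R.length * (z.length + 1) ≤ m) (c : Bool) :
    Run propagate (matReg c .zero) (matStore p z R k)
      (matReg (c || Row.conflict z R) .zero) (matStore p z (Row.propagate z R) k)
      (propagateTime n m) := by
  have hs := length_colSums hR
  have h1 := (pass_sumSymb_rows (n := n) (matReg c .zero) { cnf := p, cnt := k } [] R z [] hR hzn).run rfl
  have h2 := (pass_checkCell (matReg c .zero) { cnf := p, mat := encodeRows R, cnt := k }
    (Row.colSums z R) [] c).run rfl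
  have h3 := (pass_propagateSymb_rows (n := n) { cnf := p, cnt := k } [] (Row.colSums z R)
    (by omega) R [] (c || (Row.colSums z R).any (· = .zero))
    (fun r hr => (hR r hr).trans hs.symm)).run rfl
  simp only [List.append_nil] at h1 h2 h3
  have hl := length_encodeRows R hR
  have hl' : (encodeRows (Row.propagate z R)).length = R.length * (z.length + 1) := by
    rw [length_encodeRows (k := z.length) _ (length_of_mem_propagate hR), Row.propagate,
      List.length_map]
  have e1 : Run (.loop mat' fun s => .push mat s) (matReg c .zero)
      { cnf := p, col := Row.colSums z R, mat' := (encodeRows R).reverse, cnt := k }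
      (matReg c .zero) { cnf := p, col := Row.colSums z R, mat := encodeRows R, cnt := k }
      (2 * m + 1) :=
    Run.congr (.move (by decide) _) rfl (by simp) (by simp; omega)
  have e2 : Run (.loop col' fun s => .push col s)
      (matReg (c || (Row.colSums z R).any (· = .zero)) .zero)
      { cnf := p, col' := (Row.colSums z R).reverse, mat := encodeRows R, cnt := k }
      (matReg (c || (Row.colSums z R).any (· = .zero)) .zero)
      { cnf := p, col := Row.colSums z R, mat := encodeRows R, cnt := k } (2 * n + 1) :=
    Run.congr (.move (by decide) _) rfl (by simp) (by simp; omega)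
  have e3 : Run (.loop mat' fun s => .push mat s) (matReg (c || Row.conflict z R) .zero)
      { cnf := p, col := Row.colSums z R, mat' := (encodeRows (Row.propagate z R)).reverse, cnt := k }
      (matReg (c || Row.conflict z R) .zero)
      { cnf := p, col := Row.colSums z R, mat := encodeRows (Row.propagate z R), cnt := k }
      (2 * m + 1) :=
    Run.congr (.move (by decide) _) rfl (by simp) (by simp; omega)
  -- A constant list is its own reverse, so the zeros can be moved freely.
  have hz' : z.reverse = z := by
    rw [hz, List.reverse_replicate]
  have e4 : Run (.loop col fun _ => .push col' .zero) (matReg (c || Row.conflict z R) .zero)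
      { cnf := p, col := Row.colSums z R, mat := encodeRows (Row.propagate z R), cnt := k }
      (matReg (c || Row.conflict z R) .zero)
      { cnf := p, col' := z, mat := encodeRows (Row.propagate z R), cnt := k } (2 * n + 1) :=
    Run.congr (.move (by decide) _) rfl (by simp [hs, ← hz, hz']) (by simp; omega)
  have e5 : Run (.loop col' fun s => .push col s) (matReg (c || Row.conflict z R) .zero)
      { cnf := p, col' := z, mat := encodeRows (Row.propagate z R), cnt := k }
      (matReg (c || Row.conflict z R) .zero)
      { cnf := p, col := z, mat := encodeRows (Row.propagate z R), cnt := k } (2 * n + 1) :=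
    Run.congr (.move (by decide) _) rfl (by simp [hz']) (by simp; omega)
  have h3' : Run (.loop mat propagateSymb) (matReg (c || (Row.colSums z R).any (· = .zero)) .zero)
      { cnf := p, col := Row.colSums z R, mat := encodeRows R, cnt := k }
      (matReg (c || Row.conflict z R) .zero)
      { cnf := p, col := Row.colSums z R, mat' := (encodeRows (Row.propagate z R)).reverse, cnt := k }
      ((encodeRows R).length * (6 * n + 10 + 1) + 1) := by
    simpa only [Row.conflict, Bool.or_assoc, Row.propagate] using h3
  refine (h1.seq (e1.seq (h2.seq (e2.seq (h3'.seq (e3.seq (e4.seq e5))))))).mono ?_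
  rw [hl, hs]
  simp only [propagateTime]
  have i1 := Nat.mul_le_mul_right (2 * n + 4) hm
  have i2 := Nat.mul_le_mul_right (6 * n + 11) hm
  simp only [add_assoc, Nat.reduceAdd] at i1 i2 ⊢
  omega

end Machine

end ReadOnce

namespace ReadOnce

/-! ### The whole program and its polynomial bound -/

namespace Machine

open Stack

variable {n : ℕ}

/-- Rounds preserve the dimensions of the matrix, so the same bound serves for each of them. -/
theorem pass_propagate {m : ℕ} (p : List Symb) {z : List Cell}
    (hz : z = List.replicate z.length .zero) (hzn : z.length ≤ n) :
    ∀ (j : ℕ) {R R' : List Row} {c b : Bool} (_ : Row.rounds z j R c = (R', b))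
      (_ : ∀ r ∈ R, r.1.length = z.length) (_ : R.length * (z.length + 1) ≤ m),
    Pass cnt (fun _ => propagate) (propagateTime n m) (List.replicate j ()) (matReg c .zero)
      (matStore p z R (List.replicate j ())) (matReg b .zero) (matStore p z R' [])
  | 0, R, R', c, b, h, _, _ => by
    obtain ⟨rfl, rfl⟩ := Prod.mk.inj h
    exact Pass.nil
  | j + 1, R, R', c, b, h, hR, hm => by
    refine Pass.cons rfl (run_propagate p (List.replicate j ()) hz hzn hR hm c)
      (pass_propagate p hz hzn j h (length_of_mem_propagate hR) ?_)
    rwa [Row.propagate, List.length_map]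

theorem rounds_length {z : List Cell} : ∀ (j : ℕ) {R R' : List Row} {c b : Bool}
    (_ : Row.rounds z j R c = (R', b)) (_ : ∀ r ∈ R, r.1.length = z.length),
    (∀ r ∈ R', r.1.length = z.length) ∧ R'.length = R.length
  | 0, R, R', c, b, h, hR => by
    obtain ⟨rfl, rfl⟩ := Prod.mk.inj h
    exact ⟨hR, rfl⟩
  | j + 1, R, R', c, b, h, hR => by
    obtain ⟨h1, h2⟩ := rounds_length j h (length_of_mem_propagate hR)
    exact ⟨h1, by rw [h2, Row.propagate, List.length_map]⟩

theorem pass_mixedSymb_cells (r : Reg) (S : Store) (q : List (Cell ⊕ Bool)) :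
    ∀ (es : List Cell) (a b : Bool),
    Pass mat mixedSymb 1 (es.map .inl) { r with hasZero := a, hasNonzero := b }
      { S with mat := es.map .inl ++ q }
      { r with
        hasZero := a || es.any (· = .zero), hasNonzero := b || es.any (· ≠ .zero) }
      { S with mat := q }
  | [], a, b => by simpa using Pass.nil
  | e :: es, a, b => by
    refine Pass.cons rfl Run.set ?_
    simpa [Bool.or_assoc] using pass_mixedSymb_cells r S q es (a || e = .zero) (b || e ≠ .zero)

theorem pass_mixedSymb_rows (r : Reg) (S : Store) : ∀ (R : List Row) (a : Bool),
    Pass mat mixedSymb 1 (encodeRows R) { r with hasZero := false, hasNonzero := false, mixed := a }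
      { S with mat := encodeRows R }
      { r with hasZero := false, hasNonzero := false, mixed := a || Row.mixed R }
      { S with mat := [] }
  | [], a => by simpa [encodeRows, Row.mixed] using Pass.nil
  | (es, o) :: R, a => by
    have h1 := pass_mixedSymb_cells { r with mixed := a } S (.inr o :: encodeRows R) es false false
    have h2 := pass_mixedSymb_rows r S R
      (a || (es.any (· = .zero) && es.any (· ≠ .zero)))
    have h3 := h1.append ((Pass.single (l := encodeRows R) (a := Sum.inr o) rfl Run.set).append
      (by simpa using h2))
    simpa [encodeRows, encodeRow, Row.mixed, Bool.or_assoc] using h3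

/-- The time for the whole program on an input of length at most `n`. -/
def mainTime {R : Type} [Semiring R] (n : R) : R :=
  n * (inpTime n + 1) + n * (propagateTime n (n * (n + 1)) + 1) + 4 * (n * (n + 1)) + 4 * n + 10

theorem length_matrix (C D : Groups) : (matrix C D).length = D.length :=
  List.length_map _

theorem length_of_mem_matrix {C D : Groups} : ∀ r ∈ matrix C D, r.1.length = C.length := by
  simp [matrix, rowOf]

theorem run_main {E : Expression} (hE : (encodeExpression E).length ≤ n) {R : List Row} {b : Bool}
    (hR : Row.rounds (List.replicate E.cnf.length .zero) (E.dnf.length + 1)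
      (matrix E.cnf E.dnf) false = (R, b)) :
    ∃ r, Run main {} { inp := encodeExpression E } r { out := [b || !Row.mixed R] } (mainTime n) := by
  -- The separator symbol leaves room for the additional round: `|D| + 1 ≤ n`.
  have hlen : (encodeGroups E.cnf).length ≤ n ∧ (encodeGroups E.dnf).length + 1 ≤ n := by
    simp only [encodeExpression, List.length_append, List.length_cons] at hE
    omega
  have hC : E.cnf.length ≤ n := (length_le_length_encodeGroups _).trans hlen.1
  have hD : E.dnf.length + 1 ≤ n := (Nat.succ_le_succ (length_le_length_encodeGroups _)).trans hlen.2
  have hm : E.dnf.length * (E.cnf.length + 1) ≤ n * (n + 1) :=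
    Nat.mul_le_mul (by omega) (by omega)
  have hM := length_of_mem_matrix (C := E.cnf) (D := E.dnf)
  have h0 := run_inp hE
  have h1 : Run (.loop mat' fun s => .push mat s) (dnfReg false)
      (dnfStore E.cnf [] [] (fun _ => 0) (encodeRows (matrix E.cnf E.dnf)).reverse
        (List.replicate (E.dnf.length + 1) ())) (dnfReg false)
      (matStore (encodeGroups E.cnf) (List.replicate E.cnf.length .zero) (matrix E.cnf E.dnf)
        (List.replicate (E.dnf.length + 1) ())) (2 * (n * (n + 1)) + 1) := by
    refine Run.congr (.move (by decide) _) rfl (by simp [List.map_const', Cell.sat]) ?_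
    simp only [Store.get, List.length_reverse, length_encodeRows _ hM, length_matrix]
    omega
  have h2 := (pass_propagate (n := n) (m := n * (n + 1)) (encodeGroups E.cnf)
    (z := List.replicate E.cnf.length .zero) (by simp) (by simpa) _ hR (by simpa using hM)
    (by simpa [length_matrix] using hm)).run rfl
  obtain ⟨hR1, hR2⟩ := rounds_length _ hR (by simpa using hM)
  have h3 := (pass_mixedSymb_rows (matReg b .zero) (matStore (encodeGroups E.cnf)
    (List.replicate E.cnf.length .zero) R []) R false).run rfl
  refine ⟨_, Run.congr (h0.seq (h1.seq (h2.seq (h3.seq (Run.clear.seq (Run.clear.seq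
    (Run.read Run.push))))))) rfl (by simp) ?_⟩
  have hl := length_encodeRows R hR1
  rw [hl, hR2, length_matrix]
  simp only [Store.get, Store.set, List.length_replicate]
  have i1 := Nat.mul_le_mul_right (propagateTime n (n * (n + 1)) + 1) hD
  simp only [mainTime]
  have := hlen.1
  omega

/-- The time bounds are defined over any semiring, so the same expression gives the polynomial and
its values. -/
theorem mainTime_eval (n : ℕ) : (mainTime (Polynomial.X : Polynomial ℕ)).eval n = mainTime n := by
  simp [mainTime, inpTime, scanTime, propagateTime]

end Machine

open Machine in
theorem nonempty_outputs {E : Expression} (hE : E.Admissible) {b : Bool}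
    (hb : b = true ↔ IsReadOnceFunction E.eval) :
    Nonempty (Turing.TM2OutputsInTime (Cmd.machine main {} Stack.inp Stack.out)
      (encodeExpression E) (some [b]) (mainTime (encodeExpression E).length + 1)) := by
  obtain ⟨r, h⟩ := run_main (E := E) le_rfl rfl
  have hb' := hE.isReadOnceFunction_iff (Nat.lt_succ_self _) rfl
  rw [← Bool.eq_iff_iff.2 (hb.trans hb')] at h
  have h0 : ({} : Store).get = fun _ => [] := by
    funext k
    cases k <;> rfl
  refine Cmd.Exec.outputs (Γ := Stack.Alphabet) (k₁ := .out) (r' := r) (l' := [b]) ?_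
  have h1 := Store.get_set {} .inp (encodeExpression E)
  have h2 := Store.get_set {} .out [b]
  rw [h0] at h1 h2
  rw [← h1, ← h2]
  exact h

end ReadOnce

theorem theorem2 :
    ReadOnce.PolyTimeDecidable ReadOnce.encodeExpression ReadOnce.Expression.Admissible
      (fun E => ReadOnce.IsReadOnceFunction E.eval) := by
  classical
  -- The function to be computed may be chosen classically; its algorithmic content lies in
  -- `outputsFun`.
  refine ⟨fun a => decide (ReadOnce.IsReadOnceFunction a.1.eval), fun a => decide_eq_true_iff,
    { tm := ReadOnce.Cmd.machine ReadOnce.Machine.main {} .inp .out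
      inputAlphabet := Equiv.refl ReadOnce.Symb
      outputAlphabet := Equiv.refl Bool
      time := ReadOnce.Machine.mainTime Polynomial.X + 1
      outputsFun := fun a => ?_ }, fun (k : ReadOnce.Stack) => (inferInstance : Finite k.Alphabet)⟩
  have h := (ReadOnce.nonempty_outputs a.2 (b := decide (ReadOnce.IsReadOnceFunction a.1.eval))
    decide_eq_true_iff).some
  have e {α : Type} (l : List α) : l.map (Equiv.refl α).invFun = l := List.map_id l
  have e1 : (ReadOnce.Machine.mainTime Polynomial.X + 1 : Polynomial ℕ).eval
      (ReadOnce.encodeExpression a.1).length =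
        ReadOnce.Machine.mainTime (ReadOnce.encodeExpression a.1).length + 1 := by
    simp [ReadOnce.Machine.mainTime_eval]
  rw [e1]
  exact (e (ReadOnce.encodeExpression a.1)).symm ▸ h
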